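/- Let $k\ge 2$ and $m>2$ be integers, let $U\subset\mathbb R^{km}$ be open and let $\omega$ be a smooth closed $m$-form on $U$ of (constant) linear type $$\eta=dx^{1}\wedge\dots\wedge dx^{m}+dx^{m+1}\wedge\dots\wedge dx^{2m}+\dots+dx^{(k-1)m+1}\wedge\dots\wedge dx^{km},$$ that is, for every $x\in U$ there is a linear automorphism $L$ of $\mathbb R^{km}$ with $\omega_x=L^*\eta$. The rank of an alternating form $\alpha$ on a vector space is the codimension of its kernel $\{v\mid \iota_v\alpha=0\}$. For an open set $V\subset U$, a decomposition of $\omega$ on $V$ is a $k$-tuple $(\omega_1,\dots,\omega_k)$ of smooth $m$-forms on $V$, each of rank $m$ at every point of $V$, such that $\omega|_V=\omega_1+\dots+\omega_k$. The pair $(V,\omega)$ is called flat if for every $p\in V$ there is a smooth chart $\phi$ of $V$ defined on an open neighbourhood $W\subset V$ of $p$, with values in $T_pV=\mathbb R^{km}$, such that $\phi(p)=0$ and $\phi^*\omega_p=\omega|_W$, where $\omega_p$ is regarded as a constant-coefficient form. Then: (1) Existence: $\omega$ has a decomposition on every simply connected open $V\subset U$ (hence near every point of $U$, and on $U$ itself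 if $U$ is simply connected). (2) Uniqueness: if $(\omega_i)$ and $(\omega_i')$ are decompositions of $\omega$ on the same connected open set $V\subset U$, then there is a permutation $\sigma$ of $\{1,\dots,k\}$ with $\omega'_i=\omega_{\sigma(i)}$ on $V$ for all $i$. (3) Flatness: if $(\omega_1,\dots,\omega_k)$ is a decomposition of $\omega$ on an open set $V\subset U$ (for example on $V=U$), then $(V,\omega)$ is flat if and only if $d\omega_i=0$ on $V$ for all $i\in\{1,\dots,k\}$. For arbitrary $U$, $(U,\omega)$ is flat if and only if for every decomposition $(\omega_1,\dots,\omega_k)$ of $\omega$ on an open subset of $U$ all the forms $\omega_i$ are closed. -/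

import Mathlib

noncomputable section

namespace ProductForms

/-- The space `ℝ^{km}`. Only its linear structure and its topology are used, never its norm.
The coordinate in position `i` of the `j`-th block of length `m` (both counted from `0`) is the one
with index `finProdFinEquiv (j, i) = i + m * j`. -/
abbrev Space (k m : ℕ) : Type := Fin (k * m) → ℝ

/-- The `m`-form `dx^{jm+1} ∧ ⋯ ∧ dx^{jm+m}` (for `j = 0, …, k - 1`) on `ℝ^{km}`: the determinant of
the components of `m` vectors in the `j`-th block of coordinates. -/
def blockVolume (k m : ℕ) (j : Fin k) : Space k m [⋀^Fin m]→L[ℝ] ℝ :=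
  { (Matrix.detRowAlternating (R := ℝ) (n := Fin m)).compLinearMap
      (LinearMap.funLeft ℝ ℝ fun i : Fin m => finProdFinEquiv (j, i)) with
    cont := by
      change Continuous fun v : Fin m → Space k m =>
        Matrix.det (Matrix.of fun a i : Fin m => v a (finProdFinEquiv (j, i)))
      refine Continuous.matrix_det ?_
      fun_prop }

theorem blockVolume_apply (k m : ℕ) (j : Fin k) (v : Fin m → Space k m) :
    blockVolume k m j v =
      Matrix.det (Matrix.of fun a i : Fin m => v a (finProdFinEquiv (j, i))) := rfl

/-- The constant form `dx^{1,…,m} + dx^{m+1,…,2m} + ⋯ + dx^{(k-1)m+1,…,km}`. -/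
def standardForm (k m : ℕ) : Space k m [⋀^Fin m]→L[ℝ] ℝ :=
  ∑ j : Fin k, blockVolume k m j

section General

variable {E : Type*} [NormedAddCommGroup E] [NormedSpace ℝ E] {m : ℕ}

/-- `η` and `η'` have the same linear type: some linear isomorphism pulls `η'` back to `η`. -/
def SameLinearType (η η' : E [⋀^Fin m]→L[ℝ] ℝ) : Prop :=
  ∃ L : E ≃L[ℝ] E, η = η'.compContinuousLinearMap (L : E →L[ℝ] E)

/-- The kernel `{v | ι_v η = 0}`: the vectors `v` such that `η` vanishes on every tuple that has
`v` among its entries. -/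
def formKernel (η : E [⋀^Fin m]→L[ℝ] ℝ) : Submodule ℝ E where
  carrier := {v | ∀ (w : Fin m → E) (i : Fin m), η (Function.update w i v) = 0}
  add_mem' := by
    intro a b ha hb w i
    rw [η.map_update_add, ha w i, hb w i, add_zero]
  zero_mem' := by
    intro w i
    exact η.map_coord_zero i (Function.update_self i 0 w)
  smul_mem' := by
    intro c a ha w i
    rw [η.map_update_smul, ha w i, smul_zero]

/-- The rank of an alternating form, the codimension of its kernel. -/
def formRank (η : E [⋀^Fin m]→L[ℝ] ℝ) : ℕ :=
  Module.finrank ℝ (E ⧸ formKernel η)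

/-- `α` is a smooth differential form on the open set `V` (its values off `V` play no role). -/
def IsSmoothForm (V : Set E) (α : E → E [⋀^Fin m]→L[ℝ] ℝ) : Prop :=
  ContDiffOn ℝ (⊤ : ℕ∞) α V

/-- `dα = 0` on the open set `V`. -/
def IsClosedForm (V : Set E) (α : E → E [⋀^Fin m]→L[ℝ] ℝ) : Prop :=
  ∀ x ∈ V, extDeriv α x = 0

/-- `ω = α 0 + ⋯ + α (k - 1)` on `V`, where the `α i` are smooth `m`-forms on `V` that have
rank `m` at every point of `V`. -/
structure IsRankDecomposition {k : ℕ} (V : Set E) (ω : E → E [⋀^Fin m]→L[ℝ] ℝ)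
    (α : Fin k → E → E [⋀^Fin m]→L[ℝ] ℝ) : Prop where
  smooth : ∀ i, IsSmoothForm V (α i)
  rank_eq : ∀ i, ∀ x ∈ V, formRank (α i x) = m
  sum_eq : ∀ x ∈ V, ω x = ∑ i, α i x

/-- `(V, ω)` is flat near `p`: there is a smooth chart `φ` of `V` around `p`, with values in
`T_p V = E` and `φ p = 0`, that pulls the constant-coefficient form `ω p` back to `ω`. -/
def IsFlatNear (V : Set E) (ω : E → E [⋀^Fin m]→L[ℝ] ℝ) (p : E) : Prop :=
  ∃ φ : OpenPartialHomeomorph E E,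
    p ∈ φ.source ∧ φ.source ⊆ V ∧ φ p = 0 ∧
    ContDiffOn ℝ (⊤ : ℕ∞) φ φ.source ∧ ContDiffOn ℝ (⊤ : ℕ∞) φ.symm φ.target ∧
    ∀ x ∈ φ.source, (ω p).compContinuousLinearMap (fderiv ℝ φ x) = ω x

/-- `(V, ω)` is flat: it is flat near each of its points. -/
def IsFlat (V : Set E) (ω : E → E [⋀^Fin m]→L[ℝ] ℝ) : Prop :=
  ∀ p ∈ V, IsFlatNear V ω p

end General

end ProductForms

end

noncomputable section
open scoped ContDiff Topology
open Filter Set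

namespace ProductForms

/-! ### Smoothness of maps with values in forms -/

section FormCalculus

variable {E : Type*} [NormedAddCommGroup E] [NormedSpace ℝ E] {m : ℕ}
  {X : Type*} [NormedAddCommGroup X] [NormedSpace ℝ X] {n : ℕ∞ω}

/-! Call an endomorphism symmetric for a form when it can be moved from one argument of the form to
any other. For the standard form, comparing slots forces such an endomorphism to be a scalar on each
block; the separation of different blocks needs a third slot, which is where `2 < m` enters
(`blockProj_span`). The symmetric endomorphisms thus form an algebra isomorphic to `ℝ^k`, with the
block projections as primitive idempotents, and the same holds for every form of this linear type.
Conversely, by a dimension count, a sum of `k` forms of rank `m` that equals such a form splits the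
space, and the projections of this splitting are symmetric idempotents. So the decompositions at one
point are the pullbacks by the primitive idempotents, in some order
(`IsSplitting.exists_perm_of_sum_eq`).

Being symmetric is a linear condition whose solution space has constant dimension `k`, so the
implicit function theorem makes the idempotents smooth locally (`exists_smooth_splitting`). The
ordered decompositions at the points of `V` then form a finite covering of `V`
(`isCoveringMap_proj`). Over a simply connected base it has a section, which gives existence; over a
connected base the permutation relating two sections is constant, which gives uniqueness.

If `ω` is flat near `p`, the chart pulls the constant pieces of `ω p` back to closed pieces of `ω`,
and local uniqueness identifies these with the given ones (`IsRankDecomposition.extDeriv_eq_zero`).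
If instead the pieces are closed, each is locally the pullback of its value at `p` by some map
(`exists_darboux`): flowing along the kernel reduces it to a slice of dimension `m`, where one
integration straightens a form of top degree. The block components of these `k` maps assemble to a
flat chart (`IsRankDecomposition.isFlatNear`). -/

theorem form_apply_eq_sum {ι : Type*} [Fintype ι] (b : Module.Basis ι ℝ E)
    (η : E [⋀^Fin m]→L[ℝ] ℝ) (v : Fin m → E) :
    η v = ∑ r : Fin m → ι, (∏ i, b.repr (v i) (r i)) * η fun i => b (r i) := by
  classical
  have h : v = fun i => ∑ j, b.repr (v i) j • b j := funext fun i => (b.sum_repr (v i)).symm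
  conv_lhs => rw [h]
  have := η.toMultilinearMap.map_sum (fun i j => b.repr (v i) j • b j)
  refine this.trans (Finset.sum_congr rfl fun r _ => ?_)
  exact η.toMultilinearMap.map_smul_univ (fun i => b.repr (v i) (r i)) (fun i => b (r i))

theorem contDiffAt_form_apply_const {f : X → E [⋀^Fin m]→L[ℝ] ℝ} {x : X}
    (hf : ContDiffAt ℝ n f x) (v : Fin m → E) : ContDiffAt ℝ n (fun y => f y v) x :=
  (ContinuousAlternatingMap.apply ℝ E ℝ v).contDiff.contDiffAt.comp x hf

variable [FiniteDimensional ℝ E]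

/-- The finitely many values on tuples of basis vectors determine a form linearly and injectively,
so a linear left inverse recovers `f` from them. -/
theorem contDiffAt_form_of_apply {f : X → E [⋀^Fin m]→L[ℝ] ℝ} {x : X}
    (h : ∀ v, ContDiffAt ℝ n (fun y => f y v) x) : ContDiffAt ℝ n f x := by
  classical
  let b := Module.finBasis ℝ E
  let ev : (E [⋀^Fin m]→L[ℝ] ℝ) →ₗ[ℝ] ((Fin m → Fin (Module.finrank ℝ E)) → ℝ) :=
    { toFun := fun η r => η fun i => b (r i)
      map_add' := fun _ _ => rfl
      map_smul' := fun _ _ => rfl }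
  have hinj : Function.Injective ev := fun η η' h => by
    ext v
    rw [form_apply_eq_sum b η, form_apply_eq_sum b η']
    refine Finset.sum_congr rfl fun r _ => ?_
    have := congrFun h r
    simp only [ev, LinearMap.coe_mk, AddHom.coe_mk] at this
    rw [this]
  obtain ⟨g, hg⟩ := LinearMap.exists_leftInverse_of_injective ev (LinearMap.ker_eq_bot.2 hinj)
  have hf : f = fun y => g.toContinuousLinearMap (ev (f y)) := by
    funext y
    exact (LinearMap.congr_fun hg (f y)).symm
  rw [hf]
  refine g.toContinuousLinearMap.contDiff.contDiffAt.comp x ?_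
  exact contDiffAt_pi.2 fun r => h _

theorem contDiffAt_form_apply {f : X → E [⋀^Fin m]→L[ℝ] ℝ} {u : Fin m → X → E} {x : X}
    (hf : ContDiffAt ℝ n f x) (hu : ∀ i, ContDiffAt ℝ n (u i) x) :
    ContDiffAt ℝ n (fun y => f y fun i => u i y) x := by
  classical
  let b := Module.finBasis ℝ E
  rw [show (fun y => f y fun i => u i y) = fun y => ∑ r : Fin m → Fin (Module.finrank ℝ E),
    (∏ i, b.repr (u i y) (r i)) * f y fun i => b (r i) from
    funext fun y => form_apply_eq_sum b (f y) _]
  refine ContDiffAt.sum fun r _ => ?_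
  refine ContDiffAt.mul (contDiffAt_prod fun i _ => ?_) (contDiffAt_form_apply_const hf _)
  exact (LinearMap.toContinuousLinearMap (b.coord (r i))).contDiff.contDiffAt.comp x (hu i)

theorem contDiffAt_form_comp {F : Type*} [NormedAddCommGroup F] [NormedSpace ℝ F]
    [FiniteDimensional ℝ F] {f : X → E [⋀^Fin m]→L[ℝ] ℝ} {A : X → F →L[ℝ] E} {x : X}
    (hf : ContDiffAt ℝ n f x) (hA : ContDiffAt ℝ n A x) :
    ContDiffAt ℝ n (fun y => (f y).compContinuousLinearMap (A y)) x := by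
  refine contDiffAt_form_of_apply fun v => ?_
  have := contDiffAt_form_apply (u := fun i y => A y (v i)) hf
    fun i => hA.clm_apply contDiffAt_const
  exact this

end FormCalculus

/-- Serves to show that the permutation matching two families of pieces is locally constant. -/
theorem continuous_of_isClosed_fibers {X I : Type*} [TopologicalSpace X] [TopologicalSpace I]
    [Finite I] {f : X → I} (h : ∀ i, IsClosed (f ⁻¹' {i})) : Continuous f := by
  refine continuous_iff_isClosed.2 fun s _ => ?_
  have : f ⁻¹' s = ⋃ i ∈ s, f ⁻¹' {i} := by ext x; simp
  rw [this]
  exact (Set.toFinite s).isClosed_biUnion fun i _ => h i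

end ProductForms
end

noncomputable section
open scoped ContDiff Topology
open Filter Set

namespace ProductForms

/-! ### Symmetric endomorphisms and pointwise decompositions -/

section Splittings

variable {E : Type*} [NormedAddCommGroup E] [NormedSpace ℝ E] {m k : ℕ}

theorem mem_formKernel {η : E [⋀^Fin m]→L[ℝ] ℝ} {v : E} :
    v ∈ formKernel η ↔ ∀ (w : Fin m → E) (i : Fin m), η (Function.update w i v) = 0 := Iff.rfl

theorem form_update_sub (η : E [⋀^Fin m]→L[ℝ] ℝ) (w : Fin m → E) (i : Fin m) (a b : E) :
    η (Function.update w i (a - b)) = η (Function.update w i a) - η (Function.update w i b) :=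
  η.toMultilinearMap.map_update_sub w i a b

theorem form_update_sum {ι : Type*} (s : Finset ι) (η : E [⋀^Fin m]→L[ℝ] ℝ) (w : Fin m → E)
    (i : Fin m) (a : ι → E) :
    η (Function.update w i (∑ j ∈ s, a j)) = ∑ j ∈ s, η (Function.update w i (a j)) :=
  η.toMultilinearMap.map_update_sum s i a w

/-- `A` can be moved between the arguments of `η`. -/
def IsSymmetricFor (η : E [⋀^Fin m]→L[ℝ] ℝ) (A : E →L[ℝ] E) : Prop :=
  ∀ (v : Fin m → E) (i j : Fin m),
    η (Function.update v i (A (v i))) = η (Function.update v j (A (v j)))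

/-- The `P i` are the primitive idempotents of the algebra of the endomorphisms which are symmetric
for `η`. -/
structure IsSplitting (η : E [⋀^Fin m]→L[ℝ] ℝ) (P : Fin k → E →L[ℝ] E) : Prop where
  symm : ∀ i, IsSymmetricFor η (P i)
  mul_self : ∀ i, P i * P i = P i
  mul_ne : ∀ i j, i ≠ j → P i * P j = 0
  sum_eq : ∑ i, P i = 1
  rank_eq : ∀ i, Module.finrank ℝ (LinearMap.range (P i : E →ₗ[ℝ] E)) = m
  span : ∀ A, IsSymmetricFor η A → ∃ c : Fin k → ℝ, A = ∑ i, c i • P i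
  ker_eq : formKernel η = ⊥

/-- A copy of `P` in another slot can be moved to slot `i`, where it is absorbed because `P * P =
P`. The induction removes the copies one by one. -/
theorem IsSymmetricFor.comp_eq_update {η : E [⋀^Fin m]→L[ℝ] ℝ} {P : E →L[ℝ] E}
    (hP : IsSymmetricFor η P) (hPP : P * P = P) (v : Fin m → E) (i : Fin m) :
    η.compContinuousLinearMap P v = η (Function.update v i (P (v i))) := by
  classical
  have hPP' : ∀ x, P (P x) = P x := fun x => by
    conv_rhs => rw [← hPP]
    rfl
  have key : ∀ T : Finset (Fin m), η (fun l => if l ∈ insert i T then P (v l) else v l) =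
      η (Function.update v i (P (v i))) := by
    intro T
    induction T using Finset.induction_on with
    | empty =>
      congr 1
      funext l
      by_cases hl : l = i
      · subst hl; simp
      · simp [hl]
    | insert j T hj ih =>
      rw [← ih]
      by_cases hij : i = j
      · subst hij; simp
      set w : Fin m → E := fun l => if l ∈ insert i T then P (v l) else v l with hw
      have h1 : Function.update w j (P (w j)) =
          fun l => if l ∈ insert i (insert j T) then P (v l) else v l := by
        funext l
        by_cases hl : l = j
        · subst hl; simp [hw, hj, Ne.symm hij]
        · simp [hl, hw]
      have h2 : Function.update w i (P (w i)) = w := by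
        funext l
        by_cases hl : l = i
        · subst hl; simp [hw, hPP']
        · simp [hl]
      rw [← h1, hP w j i, h2]
  have := key Finset.univ
  simpa [Function.comp_def] using this

variable {η : E [⋀^Fin m]→L[ℝ] ℝ} {P : Fin k → E →L[ℝ] E}

theorem formKernel_comp_eq_ker (hη : formKernel η = ⊥) {Q : E →L[ℝ] E}
    (hQ : IsSymmetricFor η Q) (hQQ : Q * Q = Q) :
    formKernel (η.compContinuousLinearMap Q) = LinearMap.ker (Q : E →ₗ[ℝ] E) := by
  ext v
  rw [mem_formKernel, LinearMap.mem_ker]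
  have h : ∀ (w : Fin m → E) (i : Fin m), η.compContinuousLinearMap Q (Function.update w i v) =
      η (Function.update w i (Q v)) := fun w i => by
    rw [hQ.comp_eq_update hQQ _ i]
    simp
  simp_rw [h]
  exact ⟨fun hv => by simpa [hη] using (show Q v ∈ formKernel η from hv),
    fun hv w i => η.map_coord_zero i (by simpa using hv)⟩

theorem IsSplitting.formRank_comp (h : IsSplitting η P) (i : Fin k) :
    formRank (η.compContinuousLinearMap (P i)) = m := by
  rw [formRank, formKernel_comp_eq_ker h.ker_eq (h.symm i) (h.mul_self i), ← h.rank_eq i]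
  exact (LinearMap.quotKerEquivRange (P i : E →ₗ[ℝ] E)).finrank_eq

theorem IsSplitting.sum_comp (h : IsSplitting η P) (hm : 0 < m) :
    ∑ i, η.compContinuousLinearMap (P i) = η := by
  ext v
  have : ∀ i, η.compContinuousLinearMap (P i) v =
      η (Function.update v ⟨0, hm⟩ (P i (v ⟨0, hm⟩))) :=
    fun i => (h.symm i).comp_eq_update (h.mul_self i) v _
  rw [ContinuousAlternatingMap.sum_apply]
  simp_rw [this]
  rw [← form_update_sum]
  have h1 : ∑ i, P i (v ⟨0, hm⟩) = v ⟨0, hm⟩ := by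
    rw [← sum_apply, h.sum_eq]; rfl
  rw [h1, Function.update_eq_self]

theorem IsSplitting.ne_zero (h : IsSplitting η P) (hm : 0 < m) (i : Fin k) : P i ≠ 0 := by
  intro h0
  have := h.rank_eq i
  rw [h0, LinearMap.range_eq_bot.2 (show ((0 : E →L[ℝ] E) : E →ₗ[ℝ] E) = 0 from rfl),
    finrank_bot] at this
  omega

theorem IsSplitting.sum_smul_mul (h : IsSplitting η P) (a : Fin k → ℝ) (j : Fin k) :
    (∑ i, a i • P i) * P j = a j • P j := by
  rw [Finset.sum_mul, Finset.sum_eq_single j]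
  · rw [smul_mul_assoc, h.mul_self]
  · intro i _ hi
    rw [smul_mul_assoc, h.mul_ne i j hi, smul_zero]
  · simp

theorem IsSplitting.sum_mul_sum (h : IsSplitting η P) (a b : Fin k → ℝ) :
    (∑ i, a i • P i) * (∑ i, b i • P i) = ∑ i, (a i * b i) • P i := by
  rw [Finset.mul_sum]
  refine Finset.sum_congr rfl fun j _ => ?_
  rw [mul_smul_comm, h.sum_smul_mul, smul_smul, mul_comm]

theorem IsSplitting.sum_injective (h : IsSplitting η P) (hm : 0 < m) {a b : Fin k → ℝ}
    (hab : ∑ i, a i • P i = ∑ i, b i • P i) : a = b := by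
  funext j
  have := congrArg (· * P j) hab
  simp only [h.sum_smul_mul] at this
  exact smul_left_injective ℝ (h.ne_zero hm j) this

/-- In `ℝ^k`, idempotents have coordinates `0` or `1`, and orthogonal ones have disjoint supports.
With `k` nonempty disjoint supports in a set of `k` elements, each support is a single point. -/
theorem IsSplitting.exists_perm (h : IsSplitting η P) (hm : 0 < m) {Q : Fin k → E →L[ℝ] E}
    (hQ : ∀ i, IsSymmetricFor η (Q i)) (hQQ : ∀ i, Q i * Q i = Q i)
    (hQne : ∀ i j, i ≠ j → Q i * Q j = 0) (hQ0 : ∀ i, Q i ≠ 0) :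
    ∃ σ : Equiv.Perm (Fin k), ∀ i, Q i = P (σ i) := by
  classical
  choose c hc using fun i => h.span _ (hQ i)
  have hsq : ∀ i j, c i j * c i j = c i j := fun i j => by
    have := hQQ i
    rw [hc i, h.sum_mul_sum] at this
    exact congrFun (h.sum_injective hm this) j
  have hne : ∀ i i', i ≠ i' → ∀ j, c i j * c i' j = 0 := fun i i' hii j => by
    have := hQne i i' hii
    rw [hc i, hc i', h.sum_mul_sum] at this
    have h0 : ∑ i, (c i' i * 0) • P i = (0 : E →L[ℝ] E) := by simp
    rw [← h0] at this
    simpa using congrFun (h.sum_injective hm this) j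
  have hex : ∀ i, ∃ j, c i j ≠ 0 := fun i => by
    by_contra! hcon
    exact hQ0 i (by rw [hc i]; simp [hcon])
  choose s hs using hex
  have hs1 : ∀ i, c i (s i) = 1 := fun i => mul_left_cancel₀ (hs i) (by rw [hsq, mul_one])
  have hinj : Function.Injective s := fun i i' hii => by
    by_contra hne'
    have := hne i i' hne' (s i)
    rw [hs1 i, hii, hs1 i'] at this
    norm_num at this
  refine ⟨Equiv.ofBijective s (Finite.injective_iff_bijective.1 hinj), fun i => ?_⟩
  have hsurj : Function.Surjective s := (Finite.injective_iff_surjective).1 hinj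
  rw [hc i, Finset.sum_eq_single (s i)]
  · simp [hs1]
  · intro j _ hj
    obtain ⟨i', rfl⟩ := hsurj j
    have hii : i ≠ i' := fun h => hj (by rw [h])
    have := hne i i' hii (s i')
    rw [hs1 i', mul_one] at this
    rw [this, zero_smul]
  · simp

theorem IsSplitting.pullback (h : IsSplitting η P) (L : E ≃L[ℝ] E) :
    IsSplitting (η.compContinuousLinearMap (L : E →L[ℝ] E))
      (fun i => ((L.symm : E →L[ℝ] E) * P i) * (L : E →L[ℝ] E)) := by
  have hL : (L : E →L[ℝ] E) * (L.symm : E →L[ℝ] E) = 1 := by ext; simp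
  have hL' : (L.symm : E →L[ℝ] E) * (L : E →L[ℝ] E) = 1 := by ext; simp
  have hcomp : ∀ (v : Fin m → E) (i : Fin m) (x : E),
      (η.compContinuousLinearMap (L : E →L[ℝ] E)) (Function.update v i x) =
        η (Function.update (fun l => L (v l)) i (L x)) := fun v i x => by
    rw [ContinuousAlternatingMap.compContinuousLinearMap_apply]
    congr 1
    funext l
    by_cases hl : l = i
    · subst hl; simp
    · simp [hl]
  refine ⟨fun i v a b => ?_, fun i => ?_, fun i j hij => ?_, ?_, fun i => ?_, fun A hA => ?_, ?_⟩
  · rw [hcomp, hcomp]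
    simpa using h.symm i (fun l => L (v l)) a b
  · calc _ = (L.symm : E →L[ℝ] E) * P i * ((L : E →L[ℝ] E) * (L.symm : E →L[ℝ] E)) * P i * L := by
          simp only [mul_assoc]
      _ = _ := by rw [hL, mul_one, mul_assoc _ (P i) (P i), h.mul_self]
  · calc _ = (L.symm : E →L[ℝ] E) * P i * ((L : E →L[ℝ] E) * (L.symm : E →L[ℝ] E)) * P j * L := by
          simp only [mul_assoc]
      _ = _ := by rw [hL, mul_one, mul_assoc _ (P i) (P j), h.mul_ne i j hij]; simp
  · rw [← Finset.sum_mul, ← Finset.mul_sum, h.sum_eq, mul_one, hL']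
  · rw [← h.rank_eq i]
    have : LinearMap.range ((((L.symm : E →L[ℝ] E) * P i) * (L : E →L[ℝ] E) : E →L[ℝ] E) : E →ₗ[ℝ] E)
        = (LinearMap.range (P i : E →ₗ[ℝ] E)).map (L.symm.toLinearEquiv : E →ₗ[ℝ] E) := by
      ext x
      simp only [LinearMap.mem_range, Submodule.mem_map]
      constructor
      · rintro ⟨y, rfl⟩
        exact ⟨P i (L y), ⟨L y, rfl⟩, rfl⟩
      · rintro ⟨_, ⟨y, rfl⟩, rfl⟩
        exact ⟨L.symm y, by simp⟩
    rw [this]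
    exact LinearEquiv.finrank_map_eq L.symm.toLinearEquiv _
  · obtain ⟨c, hc⟩ := h.span ((L : E →L[ℝ] E) * A * (L.symm : E →L[ℝ] E)) fun v i j => by
      have := hA (fun l => L.symm (v l)) i j
      rw [hcomp, hcomp] at this
      simpa using this
    refine ⟨c, ?_⟩
    have : A = (L.symm : E →L[ℝ] E) * ((L : E →L[ℝ] E) * A * (L.symm : E →L[ℝ] E)) * L := by
      ext; simp
    rw [this, hc, Finset.mul_sum, Finset.sum_mul]
    refine Finset.sum_congr rfl fun i _ => ?_
    rw [mul_smul_comm, smul_mul_assoc]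
  · rw [eq_bot_iff]
    intro v hv
    have : L v ∈ formKernel η := fun w i => by
      have := hv (fun l => L.symm (w l)) i
      rw [hcomp] at this
      simpa using this
    rw [h.ker_eq] at this
    simpa using this

/-- The kernels of the `β i` meet in the kernel of `η`, which is zero, so `E` embeds in the product
of the quotients and, by dimension, equals it. Let `Q i` be the projection to the factor `i`. Then
`β j` vanishes on the range of `Q i` for `j ≠ i`, and `β i` does not see `v - Q i v`; so inserting
`Q i` in any slot of `η` gives `β i`. Hence `Q i` is symmetric, and it must be one of the primitive
idempotents. -/
theorem IsSplitting.exists_perm_of_sum_eq [FiniteDimensional ℝ E] (h : IsSplitting η P)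
    (hm : 0 < m) (hE : Module.finrank ℝ E = k * m) {β : Fin k → E [⋀^Fin m]→L[ℝ] ℝ}
    (hrank : ∀ i, formRank (β i) = m) (hsum : η = ∑ i, β i) :
    ∃ σ : Equiv.Perm (Fin k), ∀ i, β i = η.compContinuousLinearMap (P (σ i)) := by
  classical
  let Φ : E →ₗ[ℝ] (∀ i, E ⧸ formKernel (β i)) := LinearMap.pi fun i => (formKernel (β i)).mkQ
  have hΦ : ∀ v i, Φ v i = 0 ↔ v ∈ formKernel (β i) := fun v i =>
    Submodule.Quotient.mk_eq_zero _
  have hΦinj : Function.Injective Φ := by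
    rw [← LinearMap.ker_eq_bot, eq_bot_iff]
    intro v hv
    rw [← h.ker_eq]
    intro w a
    rw [hsum, ContinuousAlternatingMap.sum_apply]
    exact Finset.sum_eq_zero fun i _ => (hΦ v i).1 (congrFun (LinearMap.mem_ker.1 hv) i) w a
  have hdim : Module.finrank ℝ E = Module.finrank ℝ (∀ i, E ⧸ formKernel (β i)) := by
    rw [hE, Module.finrank_pi_fintype]
    simp only [formRank] at hrank
    simp [hrank]
  let Ψ := Φ.linearEquivOfInjective hΦinj hdim
  have hΨ : ∀ v, Ψ v = Φ v := fun v => rfl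
  let Q : Fin k → E →L[ℝ] E := fun i => LinearMap.toContinuousLinearMap
    ((Ψ.symm : _ →ₗ[ℝ] E) ∘ₗ LinearMap.single ℝ (fun i => E ⧸ formKernel (β i)) i ∘ₗ
      LinearMap.proj i ∘ₗ Φ)
  have hQ : ∀ i v, Φ (Q i v) = Pi.single i (Φ v i) := fun i v => by
    rw [← hΨ]
    simp [Q]
  have hQmem : ∀ i j v, i ≠ j → Q i v ∈ formKernel (β j) := fun i j v hij => by
    rw [← hΦ, hQ, Pi.single_eq_of_ne hij.symm]
  have hQsub : ∀ i v, v - Q i v ∈ formKernel (β i) := fun i v => by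
    rw [← hΦ, map_sub, Pi.sub_apply, hQ, Pi.single_eq_same, sub_self]
  have hQη : ∀ i v a, η (Function.update v a (Q i (v a))) = β i v := fun i v a => by
    rw [hsum, ContinuousAlternatingMap.sum_apply, Finset.sum_eq_single i]
    · have := hQsub i (v a) v a
      rw [form_update_sub, Function.update_eq_self, sub_eq_zero] at this
      exact this.symm
    · intro j _ hj
      exact hQmem i j _ hj.symm v a
    · simp
  have hsymm : ∀ i, IsSymmetricFor η (Q i) := fun i v a b => by rw [hQη, hQη]
  have hsq : ∀ i, Q i * Q i = Q i := fun i => by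
    ext v
    refine hΦinj ?_
    rw [mul_apply_eq_comp, hQ, hQ, Pi.single_eq_same]
  obtain ⟨σ, hσ⟩ := h.exists_perm hm hsymm hsq
    (fun i j hij => by
      ext v
      refine hΦinj ?_
      rw [mul_apply_eq_comp, hQ, hQ, Pi.single_eq_of_ne hij]
      simp)
    (fun i h0 => by
      have htop : formKernel (β i) = ⊤ := by
        rw [eq_top_iff]
        intro v _
        have := hQsub i v
        rwa [h0, zero_apply, sub_zero] at this
      have := hrank i
      rw [formRank, htop] at this
      have h2 : Module.finrank ℝ (E ⧸ (⊤ : Submodule ℝ E)) = 0 := Module.finrank_zero_of_subsingleton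
      omega)
  refine ⟨σ, fun i => ?_⟩
  rw [← hσ]
  ext v
  rw [(hsymm i).comp_eq_update (hsq i) v ⟨0, hm⟩, hQη]

end Splittings

/-! ### The symmetric endomorphisms of the standard form -/

section Standard

variable {k m : ℕ}

/-- The projection of `ℝ^{km}` to the `j`-th block of coordinates. -/
def blockProj (k m : ℕ) (j : Fin k) : Space k m →L[ℝ] Space k m :=
  ContinuousLinearMap.pi fun a =>
    if (finProdFinEquiv.symm a).1 = j then ContinuousLinearMap.proj a else 0

theorem blockProj_apply (j j' : Fin k) (i : Fin m) (w : Space k m) :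
    blockProj k m j w (finProdFinEquiv (j', i)) =
      if j' = j then w (finProdFinEquiv (j', i)) else 0 := by
  simp only [blockProj, ContinuousLinearMap.pi_apply, Equiv.symm_apply_apply]
  split_ifs <;> simp

theorem space_ext {v w : Space k m}
    (h : ∀ (j : Fin k) (i : Fin m), v (finProdFinEquiv (j, i)) = w (finProdFinEquiv (j, i))) :
    v = w := by
  funext a
  obtain ⟨⟨j, i⟩, rfl⟩ := finProdFinEquiv.surjective a
  exact h j i

/-- The standard basis of `ℝ^{km}`, indexed by blocks. -/
def blockBasis (k m : ℕ) (j : Fin k) (i : Fin m) : Space k m :=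
  Pi.single (finProdFinEquiv (j, i)) 1

theorem blockBasis_apply (j j' : Fin k) (i i' : Fin m) :
    blockBasis k m j i (finProdFinEquiv (j', i')) = if j' = j ∧ i' = i then 1 else 0 := by
  simp only [blockBasis, Pi.single_apply, EmbeddingLike.apply_eq_iff_eq, Prod.mk.injEq]

theorem standardForm_apply (v : Fin m → Space k m) :
    standardForm k m v =
      ∑ j, Matrix.det (Matrix.of fun a i : Fin m => v a (finProdFinEquiv (j, i))) := by
  rw [standardForm, ContinuousAlternatingMap.sum_apply]
  rfl

theorem standardForm_eq_zero {v : Fin m → Space k m}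
    (h : ∀ j, ∃ a, ∀ i, v a (finProdFinEquiv (j, i)) = 0) : standardForm k m v = 0 := by
  rw [standardForm_apply]
  refine Finset.sum_eq_zero fun j _ => ?_
  obtain ⟨a, ha⟩ := h j
  exact Matrix.det_eq_zero_of_row_eq_zero a ha

theorem exists_ne_ne (hm : 2 < m) (a b : Fin m) : ∃ r, r ≠ a ∧ r ≠ b := by
  obtain ⟨r, hr⟩ := Finset.exists_mem_notMem_of_card_lt_card (s := {a, b})
    (t := (Finset.univ : Finset (Fin m)))
    (by rw [Finset.card_univ, Fintype.card_fin]; exact (Finset.card_le_two).trans_lt hm)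
  exact ⟨r, by simpa [not_or] using hr⟩

theorem standardForm_update_basis (hm : 2 < m) (j : Fin k) (i : Fin m) (w : Space k m) :
    standardForm k m (Function.update (blockBasis k m j) i w) = w (finProdFinEquiv (j, i)) := by
  rw [standardForm_apply, Finset.sum_eq_single j]
  · have : (Matrix.of fun a i' : Fin m =>
        Function.update (blockBasis k m j) i w a (finProdFinEquiv (j, i'))) =
        (1 : Matrix (Fin m) (Fin m) ℝ).transpose.updateRow i
          fun i' => w (finProdFinEquiv (j, i')) := by
      ext a i'
      rw [Matrix.of_apply, Matrix.updateRow_apply]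
      by_cases ha : a = i
      · subst ha; simp
      · simp [ha, blockBasis_apply, Matrix.one_apply, eq_comm]
    rw [this, ← Matrix.cramer_transpose_apply]
    simp
  · intro j' _ hj
    obtain ⟨r, hr, -⟩ := exists_ne_ne hm i i
    refine Matrix.det_eq_zero_of_row_eq_zero r fun i' => ?_
    simp [hr, blockBasis_apply, hj]
  · simp

theorem blockProj_symm (j : Fin k) : IsSymmetricFor (standardForm k m) (blockProj k m j) := by
  have h : ∀ (v : Fin m → Space k m) (a : Fin m),
      standardForm k m (Function.update v a (blockProj k m j (v a))) = blockVolume k m j v := by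
    intro v a
    rw [standardForm_apply, blockVolume_apply, Finset.sum_eq_single j]
    · congr 1
      ext b i
      by_cases hb : b = a
      · subst hb; simp [blockProj_apply]
      · simp [hb]
    · intro j' _ hj
      refine Matrix.det_eq_zero_of_row_eq_zero a fun i => ?_
      simp [blockProj_apply, hj]
    · simp
  intro v a b
  rw [h, h]

theorem blockProj_span (hm : 2 < m) {A : Space k m →L[ℝ] Space k m}
    (hA : IsSymmetricFor (standardForm k m) A) :
    ∃ c : Fin k → ℝ, A = ∑ j, c j • blockProj k m j := by
  classical
  have i0 : Fin m := ⟨0, by omega⟩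
  -- Each coordinate of the image of a basis vector is a value of the form, and the symmetry of `A`
  -- gives other expressions for this value.
  have hval : ∀ j i j' i', A (blockBasis k m j i) (finProdFinEquiv (j', i')) =
      standardForm k m (Function.update (blockBasis k m j') i' (A (blockBasis k m j i))) :=
    fun j i j' i' => (standardForm_update_basis hm j' i' _).symm
  have hmove : ∀ j i j' i' l, A (blockBasis k m j i) (finProdFinEquiv (j', i')) =
      standardForm k m (Function.update (Function.update (blockBasis k m j') i' (blockBasis k m j i))
        l (A (Function.update (blockBasis k m j') i' (blockBasis k m j i) l))) := by
    intro j i j' i' l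
    rw [hval]
    have := hA (Function.update (blockBasis k m j') i' (blockBasis k m j i)) i' l
    simpa using this
  -- With `A` moved to slot `l`, slot `i'` holds a vector of block `j`, which kills the determinant
  -- of block `j'`. A third slot `r` still holds a vector of block `j'`, which kills all the others.
  have hoff : ∀ j i j' i', j' ≠ j → A (blockBasis k m j i) (finProdFinEquiv (j', i')) = 0 := by
    intro j i j' i' hj
    obtain ⟨l, hl, -⟩ := exists_ne_ne hm i' i'
    obtain ⟨r, hr, hrl⟩ := exists_ne_ne hm i' l
    rw [hmove j i j' i' l]
    refine standardForm_eq_zero fun j'' => ?_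
    by_cases hj'' : j'' = j'
    · exact ⟨i', fun a => by simp [hl.symm, blockBasis_apply, hj'', hj]⟩
    · exact ⟨r, fun a => by simp [hr, hrl, blockBasis_apply, hj'']⟩
  -- Moving `A` from slot `i'` to slot `i` has the effect of exchanging these two arguments, so the
  -- coordinate equals its own negative.
  have hdiag : ∀ j i i', i' ≠ i → A (blockBasis k m j i) (finProdFinEquiv (j, i')) = 0 := by
    intro j i i' hi
    have h1 := hmove j i j i' i
    rw [hval] at h1
    have h2 := (standardForm k m).toAlternatingMap.map_swap
      (Function.update (blockBasis k m j) i' (A (blockBasis k m j i))) hi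
    have h3 : (Function.update (blockBasis k m j) i' (A (blockBasis k m j i))) ∘ Equiv.swap i' i =
        Function.update (Function.update (blockBasis k m j) i' (blockBasis k m j i)) i
          (A (Function.update (blockBasis k m j) i' (blockBasis k m j i) i)) := by
      funext b
      by_cases hb : b = i
      · subst hb; simp [hi.symm]
      by_cases hb' : b = i'
      · subst hb'; simp [hi, hi.symm]
      · simp [hb, hb', Equiv.swap_apply_of_ne_of_ne hb' hb]
    rw [h3] at h2
    simp only [ContinuousAlternatingMap.coe_toAlternatingMap] at h2
    rw [h2] at h1
    rw [hval]
    linarith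
  refine ⟨fun j => A (blockBasis k m j i0) (finProdFinEquiv (j, i0)), ?_⟩
  -- All the diagonal entries of block `j` are the form on its basis tuple with `A` applied in one
  -- slot, and the choice of slot is immaterial.
  have hself : ∀ j i, A (blockBasis k m j i) (finProdFinEquiv (j, i)) =
      A (blockBasis k m j i0) (finProdFinEquiv (j, i0)) := by
    intro j i
    have hup : Function.update (blockBasis k m j) i (blockBasis k m j i) = blockBasis k m j :=
      Function.update_eq_self _ _
    rw [hmove j i j i i0, hup, ← hval]
  have hbasis : ∀ j i, A (blockBasis k m j i) =
      (∑ j', A (blockBasis k m j' i0) (finProdFinEquiv (j', i0)) • blockProj k m j')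
        (blockBasis k m j i) := by
    intro j i
    refine space_ext fun j' i' => ?_
    rw [sum_apply, Finset.sum_apply, Finset.sum_eq_single j']
    · simp only [smul_apply, Pi.smul_apply, smul_eq_mul, blockProj_apply,
        if_true, blockBasis_apply]
      by_cases hj : j' = j
      · subst hj
        by_cases hi : i' = i
        · subst hi; simp [hself]
        · simp [hi, hdiag j' i i' hi]
      · simp [hj, hoff j i j' i' hj]
    · intro b _ hb
      simp [blockProj_apply, hb.symm]
    · simp
  refine ContinuousLinearMap.coe_injective (LinearMap.pi_ext' fun a => ?_)
  obtain ⟨⟨j, i⟩, rfl⟩ := finProdFinEquiv.surjective a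
  ext1
  exact hbasis j i

theorem isSplitting_standardForm (hm : 2 < m) :
    IsSplitting (standardForm k m) (blockProj k m) := by
  refine ⟨blockProj_symm, fun j => ?_, fun j j' hj => ?_, ?_, fun j => ?_,
    fun A hA => blockProj_span hm hA, ?_⟩
  · refine ContinuousLinearMap.ext fun v => space_ext fun a b => ?_
    rw [mul_apply_eq_comp, blockProj_apply, blockProj_apply]
    split_ifs <;> rfl
  · refine ContinuousLinearMap.ext fun v => space_ext fun a b => ?_
    rw [mul_apply_eq_comp, blockProj_apply, blockProj_apply]
    split_ifs with h1 h2
    · exact absurd (h1.symm.trans h2) hj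
    · rfl
    · rfl
  · refine ContinuousLinearMap.ext fun v => space_ext fun a b => ?_
    rw [sum_apply, Finset.sum_apply]
    simp [blockProj_apply]
  · let f : (Fin m → ℝ) →ₗ[ℝ] Space k m :=
      LinearMap.pi fun a =>
        if (finProdFinEquiv.symm a).1 = j then LinearMap.proj (finProdFinEquiv.symm a).2 else 0
    have hf : ∀ u j' i, f u (finProdFinEquiv (j', i)) = if j' = j then u i else 0 := fun u j' i => by
      simp only [f, LinearMap.pi_apply, Equiv.symm_apply_apply]
      split_ifs <;> rfl
    have hinj : Function.Injective f := fun u v h => by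
      funext i
      have := congrFun h (finProdFinEquiv (j, i))
      simpa [hf] using this
    have hrange : LinearMap.range (blockProj k m j : Space k m →ₗ[ℝ] Space k m) =
        LinearMap.range f := by
      ext x
      simp only [LinearMap.mem_range]
      constructor
      · rintro ⟨y, rfl⟩
        refine ⟨fun i => y (finProdFinEquiv (j, i)), space_ext fun a b => ?_⟩
        rw [hf]
        refine Eq.trans ?_ (blockProj_apply j a b y).symm
        split_ifs with h
        · rw [h]
        · rfl
      · rintro ⟨u, rfl⟩
        refine ⟨f u, space_ext fun a b => ?_⟩
        refine (blockProj_apply j a b (f u)).trans ?_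
        rw [hf]
        split_ifs <;> rfl
    rw [hrange, LinearMap.finrank_range_of_inj hinj]
    simp
  · rw [eq_bot_iff]
    intro v hv
    refine space_ext fun j i => ?_
    rw [← standardForm_update_basis hm j i v, hv]
    rfl

theorem SameLinearType.exists_isSplitting (hm : 2 < m) {η : Space k m [⋀^Fin m]→L[ℝ] ℝ}
    (h : SameLinearType η (standardForm k m)) :
    ∃ P : Fin k → Space k m →L[ℝ] Space k m, IsSplitting η P := by
  obtain ⟨L, rfl⟩ := h
  exact ⟨_, (isSplitting_standardForm hm).pullback L⟩

end Standard
end ProductForms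
end

noncomputable section
open scoped ContDiff Topology
open Filter Set

namespace ProductForms

/-! ### Smooth inverse and implicit functions in Banach spaces -/

section InverseFunction

variable {E F : Type*} [NormedAddCommGroup E] [NormedSpace ℝ E] [CompleteSpace E]
  [NormedAddCommGroup F] [NormedSpace ℝ F]

/-- The source is cut down to the open set where the derivative is invertible, so that the inverse
is smooth on the whole target and not only near one point. -/
theorem exists_smooth_openPartialHomeomorph {f : E → F} {s : Set E} (hs : IsOpen s)
    (hf : ContDiffOn ℝ ∞ f s) {a : E} (ha : a ∈ s) {f' : E ≃L[ℝ] F}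
    (hf' : HasFDerivAt f (f' : E →L[ℝ] F) a) :
    ∃ e : OpenPartialHomeomorph E F, a ∈ e.source ∧ e.source ⊆ s ∧ (e : E → F) = f ∧
      ContDiffOn ℝ ∞ e.symm e.target := by
  have hfa : ContDiffAt ℝ ∞ f a := hf.contDiffAt (hs.mem_nhds ha)
  let e₀ := hfa.toOpenPartialHomeomorph f hf' (by simp)
  let t : Set E := s ∩ fderiv ℝ f ⁻¹' range ((↑) : (E ≃L[ℝ] F) → E →L[ℝ] F)
  have ht : IsOpen t :=
    (hf.continuousOn_fderiv_of_isOpen hs (by simp)).isOpen_inter_preimage hs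
      ContinuousLinearEquiv.isOpen
  have hat : a ∈ t := ⟨ha, f', hf'.fderiv.symm⟩
  refine ⟨e₀.restrOpen t ht, ⟨hfa.mem_toOpenPartialHomeomorph_source hf' (by simp), hat⟩,
    fun x hx => hx.2.1, rfl, fun y hy => ?_⟩
  have hx := (e₀.restrOpen t ht).map_target hy
  obtain ⟨g, hg⟩ := hx.2.2
  have hxs : ((e₀.restrOpen t ht).symm y) ∈ s := hx.2.1
  have hfx : ContDiffAt ℝ ∞ f ((e₀.restrOpen t ht).symm y) := hf.contDiffAt (hs.mem_nhds hxs)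
  refine ((e₀.restrOpen t ht).contDiffAt_symm hy (f₀' := g) ?_ hfx).contDiffWithinAt
  rw [hg]
  exact (hfx.differentiableAt (by simp)).hasFDerivAt

variable {Y Z : Type*} [NormedAddCommGroup Y] [NormedSpace ℝ Y] [CompleteSpace Y]
  [NormedAddCommGroup Z] [NormedSpace ℝ Z]

/-- The inverse function theorem for `(x, y) ↦ (x, f (x, y))`. The last clause, local uniqueness of
the zeros, is what later identifies rescaled solutions of the flow equation. -/
theorem exists_smooth_implicit {f : E × Y → Z} {s : Set (E × Y)} (hs : IsOpen s)
    (hf : ContDiffOn ℝ ∞ f s) {x₀ : E} {y₀ : Y} (h₀ : (x₀, y₀) ∈ s) (hf₀ : f (x₀, y₀) = 0)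
    {f' : Y ≃L[ℝ] Z} (hf' : HasFDerivAt (fun y => f (x₀, y)) (f' : Y →L[ℝ] Z) y₀) :
    ∃ ψ : E → Y, ∃ W : Set E, IsOpen W ∧ x₀ ∈ W ∧ ContDiffOn ℝ ∞ ψ W ∧ ψ x₀ = y₀ ∧
      (∀ x ∈ W, (x, ψ x) ∈ s ∧ f (x, ψ x) = 0) ∧
      ∀ᶠ q in 𝓝 (x₀, y₀), f q = 0 → q.2 = ψ q.1 := by
  have hd : HasFDerivAt f (fderiv ℝ f (x₀, y₀)) (x₀, y₀) :=
    ((hf.contDiffAt (hs.mem_nhds h₀)).differentiableAt (by simp)).hasFDerivAt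
  have hinr : ∀ w, fderiv ℝ f (x₀, y₀) (0, w) = f' w := by
    have h1 : HasFDerivAt (fun y : Y => (x₀, y)) (ContinuousLinearMap.inr ℝ E Y) y₀ :=
      hasFDerivAt_prodMk_right x₀ y₀
    have h2 := (hd.comp y₀ h1).unique hf'
    intro w
    simpa using congrArg (fun g : Y →L[ℝ] Z => g w) h2
  let A : E →L[ℝ] Z := fderiv ℝ f (x₀, y₀) ∘L ContinuousLinearMap.inl ℝ E Y
  let Θ' : (E × Y) ≃L[ℝ] (E × Z) := (ContinuousLinearEquiv.refl ℝ E).skewProd f' A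
  have hΘ' : HasFDerivAt (fun q : E × Y => (q.1, f q)) (Θ' : E × Y →L[ℝ] E × Z) (x₀, y₀) := by
    refine (hasFDerivAt_fst.prodMk hd).congr_fderiv ?_
    ext v
    · simp [Θ']
    · simp [Θ', A]
    · simp [Θ']
    · simp [Θ', hinr]
  obtain ⟨e, hae, hes, he, hsymm⟩ := exists_smooth_openPartialHomeomorph hs
    (contDiffOn_fst.prodMk hf) h₀ hΘ'
  have hι : ContDiff ℝ ∞ fun x : E => (x, (0 : Z)) := contDiff_id.prodMk contDiff_const
  refine ⟨fun x => (e.symm (x, 0)).2, (fun x => (x, 0)) ⁻¹' e.target,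
    e.open_target.preimage hι.continuous, ?_, ?_, ?_, fun x hx => ?_, ?_⟩
  · have := e.map_source hae
    rw [he] at this
    simpa [hf₀] using this
  · exact contDiff_snd.comp_contDiffOn (hsymm.comp hι.contDiffOn fun x hx => hx)
  · have := e.left_inv hae
    rw [he] at this
    simp only [hf₀] at this
    simp only [this]
  · have h1 := e.right_inv hx
    have h2 : e (e.symm (x, 0)) = ((e.symm (x, 0)).1, f (e.symm (x, 0))) := by rw [he]
    rw [h1] at h2
    have h3 : (e.symm (x, 0)).1 = x := (congrArg Prod.fst h2).symm
    have h4 : (x, (e.symm (x, 0)).2) = e.symm (x, 0) := Prod.ext h3.symm rfl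
    rw [h4]
    exact ⟨hes (e.map_target hx), (congrArg Prod.snd h2).symm⟩
  · filter_upwards [e.open_source.mem_nhds hae] with q hq hfq
    have := e.left_inv hq
    rw [he] at this
    simp only [hfq] at this
    rw [this]

end InverseFunction

/-! ### Smooth continuation of an idempotent in kernels of constant dimension -/

section Idempotents

variable {X T 𝔸 : Type*} [NormedAddCommGroup X] [NormedSpace ℝ X] [CompleteSpace X]
  [NormedAddCommGroup T] [NormedSpace ℝ T] [FiniteDimensional ℝ T]
  [NormedRing 𝔸] [NormedAlgebra ℝ 𝔸] [FiniteDimensional ℝ 𝔸]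

theorem exists_smooth_idempotent_mem_ker {U : Set X} (hU : IsOpen U) {D : X → 𝔸 →ₗ[ℝ] T}
    (hD : ContDiffOn ℝ ∞ (fun q : X × 𝔸 => D q.1 q.2) (U ×ˢ univ)) {k : ℕ}
    (hk : ∀ x ∈ U, Module.finrank ℝ (LinearMap.ker (D x)) = k)
    (hsq : ∀ x ∈ U, ∀ A, D x A = 0 → D x (A * A) = 0) {p : X} (hp : p ∈ U) {e : 𝔸}
    (he : D p e = 0) (hee : e * e = e)
    (hecomm : ∀ B, D p B = 0 → D p (e * B) = 0 ∧ e * B = B * e) :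
    ∃ ψ : X → 𝔸, ∃ W : Set X, IsOpen W ∧ p ∈ W ∧ W ⊆ U ∧ ContDiffOn ℝ ∞ ψ W ∧
      ψ p = e ∧ ∀ x ∈ W, D x (ψ x) = 0 ∧ ψ x * ψ x = ψ x := by
  have := FiniteDimensional.complete ℝ 𝔸
  let N := LinearMap.ker (D p)
  let S := LinearMap.range (D p)
  obtain ⟨R', hR'⟩ := LinearMap.exists_leftInverse_of_injective S.subtype
    (LinearMap.ker_eq_bot.2 S.injective_subtype)
  obtain ⟨Q', hQ'⟩ := LinearMap.exists_leftInverse_of_injective N.subtype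
    (LinearMap.ker_eq_bot.2 N.injective_subtype)
  let R : T →L[ℝ] S := R'.toContinuousLinearMap
  let Q : 𝔸 →L[ℝ] N := Q'.toContinuousLinearMap
  have hR : ∀ A, R (D p A) = 0 → D p A = 0 := fun A hA => by
    have := LinearMap.congr_fun hR' ⟨D p A, LinearMap.mem_range_self _ _⟩
    have h2 : R' (D p A) = 0 := hA
    simp only [LinearMap.comp_apply, Submodule.subtype_apply, h2, LinearMap.id_apply] at this
    exact (congrArg Subtype.val this).symm
  have hQ : ∀ A, D p A = 0 → Q A = 0 → A = 0 := fun A hA hQA => by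
    have := LinearMap.congr_fun hQ' ⟨A, hA⟩
    have h2 : Q' A = 0 := hQA
    simp only [LinearMap.comp_apply, Submodule.subtype_apply, h2, LinearMap.id_apply] at this
    exact (congrArg Subtype.val this).symm
  have hdim : Module.finrank ℝ 𝔸 = Module.finrank ℝ (S × N) := by
    rw [Module.finrank_prod]
    exact ((D p).finrank_range_add_finrank_ker).symm
  have hUo : IsOpen (U ×ˢ (univ : Set 𝔸)) := hU.prod isOpen_univ
  -- The linear maps whose bijectivity makes the kernels vary smoothly.
  let M : X → 𝔸 →L[ℝ] (S × N) := fun x => (R ∘L (D x).toContinuousLinearMap).prod Q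
  have hM : ∀ x A, M x A = (R (D x A), Q A) := fun x A => rfl
  have hMcont : ContinuousOn M U := continuousOn_clm_apply.2 fun A x hx =>
    (ContinuousAt.prodMk (R.continuous.continuousAt.comp
      (((hD.contDiffAt (x := (x, A)) (hUo.mem_nhds ⟨hx, trivial⟩)).continuousAt).comp
        (f := fun x => (x, A)) (by fun_prop))) continuousAt_const).continuousWithinAt
  have hMp : Function.Injective (M p) := by
    rw [injective_iff_map_eq_zero]
    intro A hA
    rw [hM, Prod.mk_eq_zero] at hA
    exact hQ A (hR A hA.1) hA.2
  let V : Set X := U ∩ M ⁻¹' range ((↑) : (𝔸 ≃L[ℝ] (S × N)) → _)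
  have hV : IsOpen V := hMcont.isOpen_inter_preimage hU ContinuousLinearEquiv.isOpen
  have hpV : p ∈ V := by
    refine ⟨hp, (LinearMap.linearEquivOfInjective (M p : 𝔸 →ₗ[ℝ] (S × N)) hMp
      hdim).toContinuousLinearEquiv, ?_⟩
    ext1 A
    rfl
  have hMx : ∀ x ∈ V, ∀ A, R (D x A) = 0 → Q A = 0 → A = 0 := by
    rintro x ⟨-, e, he⟩ A h1 h2
    have : M x A = 0 := by rw [hM, h1, h2]; rfl
    rw [← he] at this
    simpa using this
  -- The kernel of `R ∘ D x` contains that of `D x`, and `Q` embeds it in `N`. Since both `N` and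
  -- the kernel of `D x` have dimension `k`, the two kernels agree.
  have hDx : ∀ x ∈ V, ∀ A, R (D x A) = 0 → D x A = 0 := by
    intro x hx
    have hle : LinearMap.ker (D x) ≤ LinearMap.ker ((R : _ →ₗ[ℝ] S) ∘ₗ D x) :=
      LinearMap.ker_le_ker_comp _ _
    have hfin : Module.finrank ℝ (LinearMap.ker ((R : _ →ₗ[ℝ] S) ∘ₗ D x)) ≤
        Module.finrank ℝ (LinearMap.ker (D x)) := by
      rw [hk x hx.1, ← hk p hp]
      refine LinearMap.finrank_le_finrank_of_injective
        (f := (Q : _ →ₗ[ℝ] N) ∘ₗ (LinearMap.ker ((R : _ →ₗ[ℝ] S) ∘ₗ D x)).subtype) ?_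
      rw [injective_iff_map_eq_zero]
      intro A hA
      exact Subtype.ext (hMx x hx A.1 A.2 hA)
    have heq := Submodule.eq_of_le_of_finrank_le hle hfin
    intro A hA
    have : A ∈ LinearMap.ker ((R : _ →ₗ[ℝ] S) ∘ₗ D x) := hA
    rwa [← heq] at this
  -- The equation for the idempotent.
  let G : X × 𝔸 → S × N := fun q => (R (D q.1 q.2), Q (q.2 * q.2 - q.2))
  have hG : ContDiffOn ℝ ∞ G (V ×ˢ univ) :=
    (R.contDiff.comp_contDiffOn (hD.mono (prod_mono (fun x hx => hx.1) subset_rfl))).prodMk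
      (Q.contDiff.comp_contDiffOn
        ((contDiff_snd.mul contDiff_snd).sub contDiff_snd).contDiffOn)
  let L : 𝔸 →L[ℝ] (S × N) := (R ∘L (D p).toContinuousLinearMap).prod
    (Q ∘L (ContinuousLinearMap.mul ℝ 𝔸 e + (ContinuousLinearMap.mul ℝ 𝔸).flip e -
      ContinuousLinearMap.id ℝ 𝔸))
  have hL : ∀ B, L B = (R (D p B), Q (e * B + B * e - B)) := fun B => rfl
  have hLinj : Function.Injective L := by
    rw [injective_iff_map_eq_zero]
    intro B hB
    rw [hL, Prod.mk_eq_zero] at hB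
    have hDB := hR B hB.1
    obtain ⟨h1, h2⟩ := hecomm B hDB
    have h3 : e * B + B * e - B = 0 := by
      refine hQ _ ?_ hB.2
      rw [← h2, map_sub, map_add, h1, hDB]
      simp
    -- As `e` and `B` commute, `h3` says `2 * e * B = B`; multiplication by `e` leaves `e * B = 0`.
    have h4 : e * B = 0 := by
      have := congrArg (e * ·) h3
      simpa only [← h2, mul_sub, mul_add, ← mul_assoc, hee, mul_zero, add_sub_cancel_right]
        using this
    rw [← h2, h4] at h3
    simpa using h3
  let L' : 𝔸 ≃L[ℝ] (S × N) :=
    (LinearMap.linearEquivOfInjective (L : 𝔸 →ₗ[ℝ] (S × N)) hLinj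
      hdim).toContinuousLinearEquiv
  have hL' : (L' : 𝔸 →L[ℝ] (S × N)) = L := by
    ext1 A
    rfl
  have hGp : HasFDerivAt (fun A => G (p, A)) (L' : 𝔸 →L[ℝ] (S × N)) e := by
    rw [hL']
    refine HasFDerivAt.prodMk ((R ∘L (D p).toContinuousLinearMap).hasFDerivAt) ?_
    refine Q.hasFDerivAt.comp e ?_
    refine (((hasFDerivAt_id e).mul' (hasFDerivAt_id e)).sub
      (hasFDerivAt_id e)).congr_fderiv ?_
    ext1 B
    simp
  obtain ⟨ψ, W, hW, hpW, hψ, hψp, hψW, -⟩ := exists_smooth_implicit (hV.prod isOpen_univ) hG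
    (x₀ := p) (y₀ := e) ⟨hpV, trivial⟩ (by
      simp only [G]
      rw [hee, sub_self, he, map_zero, map_zero]
      rfl) hGp
  refine ⟨ψ, W, hW, hpW, fun x hx => ((hψW x hx).1.1).1, hψ, hψp, fun x hx => ?_⟩
  obtain ⟨⟨hxV, -⟩, h0⟩ := hψW x hx
  rw [Prod.mk_eq_zero] at h0
  have h1 := hDx x hxV _ h0.1
  -- By `hsq`, `ψ x * ψ x - ψ x` lies again in the kernel of `D x`, on which `Q` is injective; so
  -- the projected equation implies idempotence.
  refine ⟨h1, sub_eq_zero.1 (hMx x hxV _ ?_ h0.2)⟩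
  rw [map_sub, h1, hsq x hxV.1 _ h1, sub_zero, map_zero]

end Idempotents

/-! ### Local smooth families of splittings -/

section LocalSplitting

variable {E : Type*} [NormedAddCommGroup E] [NormedSpace ℝ E] {m k : ℕ}

theorem IsSplitting.permute {η : E [⋀^Fin m]→L[ℝ] ℝ} {P : Fin k → E →L[ℝ] E}
    (h : IsSplitting η P) (σ : Equiv.Perm (Fin k)) : IsSplitting η fun i => P (σ i) where
  symm i := h.symm _
  mul_self i := h.mul_self _
  mul_ne i j hij := h.mul_ne _ _ (σ.injective.ne hij)
  sum_eq := by rw [Equiv.sum_comp σ P, h.sum_eq]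
  rank_eq i := h.rank_eq _
  span A hA := by
    obtain ⟨c, hc⟩ := h.span A hA
    exact ⟨fun i => c (σ i), by rw [hc, ← Equiv.sum_comp σ]⟩
  ker_eq := h.ker_eq

/-- The values on tuples of basis vectors of the failure of `A` to be symmetric for `η`. -/
def symmetryDefect {ι : Type*} (b : ι → E) (η : E [⋀^Fin m]→L[ℝ] ℝ) :
    (E →L[ℝ] E) →ₗ[ℝ] (Fin m × Fin m × (Fin m → ι) → ℝ) where
  toFun A q := η (Function.update (fun l => b (q.2.2 l)) q.1 (A (b (q.2.2 q.1)))) -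
    η (Function.update (fun l => b (q.2.2 l)) q.2.1 (A (b (q.2.2 q.2.1))))
  map_add' A B := by
    funext q
    simp only [add_apply, Pi.add_apply, η.map_update_add]
    ring
  map_smul' c A := by
    funext q
    simp only [smul_apply, Pi.smul_apply, η.map_update_smul, RingHom.id_apply]
    rw [smul_sub]

/-- Both sides of the symmetry condition are multilinear in the vectors, so tuples of basis vectors
suffice. This makes the symmetric endomorphisms the kernel of one linear map to a finite-dimensional
space. -/
theorem isSymmetricFor_iff_defect {ι : Type*} [Finite ι] (b : Module.Basis ι ℝ E)
    {η : E [⋀^Fin m]→L[ℝ] ℝ} {A : E →L[ℝ] E} :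
    IsSymmetricFor η A ↔ symmetryDefect b η A = 0 := by
  classical
  constructor
  · intro h
    funext q
    exact sub_eq_zero.2 (h (fun l => b (q.2.2 l)) q.1 q.2.1)
  · intro h v i j
    let g : Fin m → MultilinearMap ℝ (fun _ : Fin m => E) ℝ := fun i =>
      η.toMultilinearMap.compLinearMap fun l => if l = i then (A : E →ₗ[ℝ] E) else LinearMap.id
    have hg : ∀ i v, g i v = η (Function.update v i (A (v i))) := fun i v => by
      have : (fun l => (if l = i then (A : E →ₗ[ℝ] E) else LinearMap.id) (v l)) =
          Function.update v i (A (v i)) := by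
        funext l
        by_cases hl : l = i
        · subst hl; simp
        · simp [hl]
      rw [← this]
      rfl
    have : g i = g j := Module.Basis.ext_multilinear (fun _ => b) fun r => by
      rw [hg, hg]
      exact sub_eq_zero.1 (congrFun h (i, j, r))
    rw [← hg, ← hg, this]

theorem contDiffAt_symmetryDefect [FiniteDimensional ℝ E] {X ι : Type*} [NormedAddCommGroup X]
    [NormedSpace ℝ X] [Fintype ι] (b : ι → E) {Ω : X → E [⋀^Fin m]→L[ℝ] ℝ} {A : X → E →L[ℝ] E}
    {x : X} (hΩ : ContDiffAt ℝ ∞ Ω x) (hA : ContDiffAt ℝ ∞ A x) :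
    ContDiffAt ℝ ∞ (fun y => symmetryDefect b (Ω y) (A y)) x := by
  have key : ∀ (r : Fin m → ι) (i : Fin m), ContDiffAt ℝ ∞
      (fun y => Ω y (Function.update (fun l => b (r l)) i (A y (b (r i))))) x := by
    intro r i
    refine contDiffAt_form_apply
      (u := fun l y => Function.update (fun l => b (r l)) i (A y (b (r i))) l) hΩ fun l => ?_
    by_cases hl : l = i
    · subst hl
      simpa using hA.clm_apply contDiffAt_const
    · simpa [hl] using contDiffAt_const
  exact contDiffAt_pi.2 fun q => (key _ _).sub (key _ _)

theorem IsSplitting.symm_sum {η : E [⋀^Fin m]→L[ℝ] ℝ} {P : Fin k → E →L[ℝ] E}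
    (h : IsSplitting η P) (c : Fin k → ℝ) {ι : Type*} [Finite ι] (b : Module.Basis ι ℝ E) :
    symmetryDefect b η (∑ i, c i • P i) = 0 := by
  rw [map_sum]
  refine Finset.sum_eq_zero fun i _ => ?_
  rw [map_smul, (isSymmetricFor_iff_defect b).1 (h.symm i), smul_zero]

theorem IsSplitting.finrank_ker_defect {η : E [⋀^Fin m]→L[ℝ] ℝ} {P : Fin k → E →L[ℝ] E}
    (h : IsSplitting η P) (hm : 0 < m) {ι : Type*} [Finite ι] (b : Module.Basis ι ℝ E) :
    Module.finrank ℝ (LinearMap.ker (symmetryDefect b η)) = k := by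
  let f : (Fin k → ℝ) →ₗ[ℝ] (E →L[ℝ] E) := Fintype.linearCombination ℝ P
  have hf : ∀ c, f c = ∑ i, c i • P i := fun c => Fintype.linearCombination_apply ℝ P c
  have hinj : Function.Injective f := fun a c hac => by
    rw [hf, hf] at hac
    exact h.sum_injective hm hac
  have : LinearMap.ker (symmetryDefect b η) = LinearMap.range f := by
    ext A
    rw [LinearMap.mem_ker, LinearMap.mem_range]
    constructor
    · intro hA
      obtain ⟨c, hc⟩ := h.span A ((isSymmetricFor_iff_defect b).2 hA)
      exact ⟨c, by rw [hf, hc]⟩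
    · rintro ⟨c, rfl⟩
      rw [hf, h.symm_sum]
  rw [this, LinearMap.finrank_range_of_inj hinj]
  simp

theorem IsSplitting.mul_comm_of_symm {η : E [⋀^Fin m]→L[ℝ] ℝ} {P : Fin k → E →L[ℝ] E}
    (h : IsSplitting η P) {A B : E →L[ℝ] E} (hA : IsSymmetricFor η A) (hB : IsSymmetricFor η B) :
    A * B = B * A := by
  obtain ⟨a, rfl⟩ := h.span A hA
  obtain ⟨c, rfl⟩ := h.span B hB
  simp_rw [h.sum_mul_sum, mul_comm]

theorem IsSplitting.defect_mul_self {η : E [⋀^Fin m]→L[ℝ] ℝ} {P : Fin k → E →L[ℝ] E}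
    (h : IsSplitting η P) {A : E →L[ℝ] E} (hA : IsSymmetricFor η A)
    {ι : Type*} [Finite ι] (b : Module.Basis ι ℝ E) : symmetryDefect b η (A * A) = 0 := by
  obtain ⟨a, rfl⟩ := h.span A hA
  rw [h.sum_mul_sum, h.symm_sum]

theorem eq_zero_of_mul_self_of_norm_lt {A : E →L[ℝ] E} (h : A * A = A) (hA : ‖A‖ < 1) : A = 0 := by
  have h1 : ‖A‖ ≤ ‖A‖ * ‖A‖ := by
    conv_lhs => rw [← h]
    exact norm_mul_le _ _
  by_contra h0
  have h2 : 0 < ‖A‖ := norm_pos_iff.2 h0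
  nlinarith

variable [FiniteDimensional ℝ E]

theorem exists_smooth_idempotent (hm : 0 < m) {U : Set E} (hU : IsOpen U)
    {Ω : E → E [⋀^Fin m]→L[ℝ] ℝ} (hΩ : ContDiffOn ℝ ∞ Ω U)
    (hsplit : ∀ x ∈ U, ∃ P : Fin k → E →L[ℝ] E, IsSplitting (Ω x) P) {p : E} (hp : p ∈ U)
    {P₀ : Fin k → E →L[ℝ] E} (hP₀ : IsSplitting (Ω p) P₀) (i : Fin k) :
    ∃ ψ : E → E →L[ℝ] E, ∃ W : Set E, IsOpen W ∧ p ∈ W ∧ W ⊆ U ∧ ContDiffOn ℝ ∞ ψ W ∧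
      ψ p = P₀ i ∧ ∀ x ∈ W, IsSymmetricFor (Ω x) (ψ x) ∧ ψ x * ψ x = ψ x := by
  have := FiniteDimensional.complete ℝ E
  let b := Module.finBasis ℝ E
  have hb : ∀ {x A}, symmetryDefect b (Ω x) A = 0 ↔ IsSymmetricFor (Ω x) A :=
    (isSymmetricFor_iff_defect b).symm
  simp_rw [← hb]
  refine exists_smooth_idempotent_mem_ker (k := k) hU ?_ (fun x hx => ?_) (fun x hx A hA => ?_) hp
    (hb.2 (hP₀.symm i)) (hP₀.mul_self i) fun B hB => ⟨?_, hP₀.mul_comm_of_symm (hP₀.symm i) (hb.1 hB)⟩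
  · intro q hq
    exact (contDiffAt_symmetryDefect b ((hΩ.contDiffAt (hU.mem_nhds hq.1)).comp q contDiffAt_fst)
      contDiffAt_snd).contDiffWithinAt
  · obtain ⟨P, hP⟩ := hsplit x hx
    exact hP.finrank_ker_defect hm b
  · obtain ⟨P, hP⟩ := hsplit x hx
    exact hP.defect_mul_self (hb.1 hA) b
  · obtain ⟨c, rfl⟩ := hP₀.span B (hb.1 hB)
    rw [hP₀.mul_comm_of_symm (hP₀.symm i) (hb.1 hB), hP₀.sum_smul_mul, map_smul,
      hb.2 (hP₀.symm i), smul_zero]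

/-- Each primitive idempotent at `p` is continued separately. Nearby, the continuations stay nonzero
and their products stay small; such a product is itself idempotent, as symmetric endomorphisms
commute, and an idempotent of norm less than `1` is zero. Thus `IsSplitting.exists_perm` applies at
every nearby point. -/
theorem exists_smooth_splitting (hm : 0 < m) {U : Set E} (hU : IsOpen U)
    {Ω : E → E [⋀^Fin m]→L[ℝ] ℝ} (hΩ : ContDiffOn ℝ ∞ Ω U)
    (hsplit : ∀ x ∈ U, ∃ P : Fin k → E →L[ℝ] E, IsSplitting (Ω x) P) {p : E} (hp : p ∈ U) :
    ∃ P : Fin k → E → E →L[ℝ] E, ∃ W : Set E, IsOpen W ∧ p ∈ W ∧ W ⊆ U ∧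
      (∀ i, ContDiffOn ℝ ∞ (P i) W) ∧ ∀ x ∈ W, IsSplitting (Ω x) fun i => P i x := by
  obtain ⟨P₀, hP₀⟩ := hsplit p hp
  choose ψ W hW hpW hWU hψ hψp hψW using
    fun i => exists_smooth_idempotent hm hU hΩ hsplit hp hP₀ i
  have hcont : ∀ i, ContinuousAt (ψ i) p := fun i =>
    (hψ i).continuousOn.continuousAt ((hW i).mem_nhds (hpW i))
  have hev : ∀ᶠ x in 𝓝 p, x ∈ U ∧ (∀ i, x ∈ W i) ∧ (∀ i, ψ i x ≠ 0) ∧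
      ∀ i j, i ≠ j → ‖ψ i x * ψ j x‖ < 1 := by
    refine (hU.eventually_mem hp).and
      ((eventually_all.2 fun i => (hW i).eventually_mem (hpW i)).and
      ((eventually_all.2 fun i => ?_).and (eventually_all.2 fun i => eventually_all.2 fun j =>
        eventually_imp_distrib_left.2 fun hij => ?_)))
    · exact (hcont i).eventually_ne (by rw [hψp]; exact hP₀.ne_zero hm i)
    · refine ((hcont i).mul (hcont j)).norm.eventually_lt continuousAt_const ?_
      simp only [Pi.mul_apply, hψp, hP₀.mul_ne i j hij, norm_zero]
      exact one_pos
  obtain ⟨T, hT, hTo, hpT⟩ := eventually_nhds_iff.1 hev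
  refine ⟨ψ, T, hTo, hpT, fun x hx => (hT x hx).1, fun i => (hψ i).mono fun x hx => (hT x hx).2.1 i,
    fun x hx => ?_⟩
  obtain ⟨hxU, hxW, hne, hlt⟩ := hT x hx
  obtain ⟨P, hP⟩ := hsplit x hxU
  have hs := fun i => (hψW i x (hxW i)).1
  have hi := fun i => (hψW i x (hxW i)).2
  obtain ⟨σ, hσ⟩ := hP.exists_perm hm hs hi (fun i j hij =>
    eq_zero_of_mul_self_of_norm_lt (by
      rw [mul_assoc, ← mul_assoc (ψ j x), hP.mul_comm_of_symm (hs j) (hs i), mul_assoc, hi,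
        ← mul_assoc, hi]) (hlt i j hij)) hne
  have := hP.permute σ
  simpa only [← hσ] using this

end LocalSplitting
end ProductForms
end

noncomputable section
open scoped ContDiff Topology
open Filter Set

namespace ProductForms

/-! ### Uniqueness, and existence by a covering space -/

section Pieces

variable {E : Type*} [NormedAddCommGroup E] [NormedSpace ℝ E] {m k : ℕ}

/-- `η` is the sum of the forms `β i`, which have rank `m`. -/
def ArePieces (η : E [⋀^Fin m]→L[ℝ] ℝ) (β : Fin k → E [⋀^Fin m]→L[ℝ] ℝ) : Prop :=
  (∀ i, formRank (β i) = m) ∧ η = ∑ i, β i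

variable {η : E [⋀^Fin m]→L[ℝ] ℝ} {P : Fin k → E →L[ℝ] E} {β γ : Fin k → E [⋀^Fin m]→L[ℝ] ℝ}

theorem IsSplitting.arePieces (h : IsSplitting η P) (hm : 0 < m) :
    ArePieces η fun i => η.compContinuousLinearMap (P i) :=
  ⟨h.formRank_comp, (h.sum_comp hm).symm⟩

theorem ArePieces.permute (h : ArePieces η β) {s : Fin k → Fin k} (hs : Function.Bijective s) :
    ArePieces η fun i => β (s i) :=
  ⟨fun _ => h.1 _, by rw [h.2, ← Equiv.sum_comp (Equiv.ofBijective s hs)]; rfl⟩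

/-- The kernel of a piece is the kernel of its projection, and distinct orthogonal nonzero
projections have distinct kernels. -/
theorem IsSplitting.comp_injective (h : IsSplitting η P) (hm : 0 < m) :
    Function.Injective fun i => η.compContinuousLinearMap (P i) := by
  intro i j hij
  by_contra hne
  refine h.ne_zero hm i ?_
  have hker : LinearMap.ker (P i : E →ₗ[ℝ] E) = LinearMap.ker (P j : E →ₗ[ℝ] E) := by
    rw [← formKernel_comp_eq_ker h.ker_eq (h.symm i) (h.mul_self i),
      ← formKernel_comp_eq_ker h.ker_eq (h.symm j) (h.mul_self j)]
    exact congrArg formKernel hij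
  ext1 v
  have h1 : P i v ∈ LinearMap.ker (P j : E →ₗ[ℝ] E) :=
    congrArg (fun A : E →L[ℝ] E => A v) (h.mul_ne j i (Ne.symm hne))
  rw [← hker] at h1
  have h2 : P i (P i v) = P i v := congrArg (fun A : E →L[ℝ] E => A v) (h.mul_self i)
  rw [← h2]
  exact h1

variable [FiniteDimensional ℝ E]

theorem IsSplitting.pieces_injective (h : IsSplitting η P) (hm : 0 < m)
    (hE : Module.finrank ℝ E = k * m) (hβ : ArePieces η β) : Function.Injective β := by
  obtain ⟨σ, hσ⟩ := h.exists_perm_of_sum_eq hm hE hβ.1 hβ.2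
  have : β = (fun i => η.compContinuousLinearMap (P i)) ∘ σ := funext hσ
  rw [this]
  exact (h.comp_injective hm).comp σ.injective

theorem IsSplitting.pieces_perm (h : IsSplitting η P) (hm : 0 < m)
    (hE : Module.finrank ℝ E = k * m) (hβ : ArePieces η β) (hγ : ArePieces η γ) :
    ∃ σ : Equiv.Perm (Fin k), ∀ i, γ i = β (σ i) := by
  obtain ⟨σ, hσ⟩ := h.exists_perm_of_sum_eq hm hE hβ.1 hβ.2
  obtain ⟨τ, hτ⟩ := h.exists_perm_of_sum_eq hm hE hγ.1 hγ.2
  exact ⟨τ.trans σ.symm, fun i => by rw [hσ, hτ]; simp⟩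

variable {Ω : E → E [⋀^Fin m]→L[ℝ] ℝ}

/-- At each point the permutation is unique because the pieces are distinct. The set where it takes
a given value is closed, being cut out by equalities of continuous forms; as there are finitely many
values, it is constant. -/
theorem exists_perm_of_isPreconnected (hm : 0 < m) (hE : Module.finrank ℝ E = k * m) {V : Set E}
    (hV : IsPreconnected V) (hsplit : ∀ x ∈ V, ∃ P : Fin k → E →L[ℝ] E, IsSplitting (Ω x) P)
    {α β : Fin k → E → E [⋀^Fin m]→L[ℝ] ℝ} (hα : ∀ i, ContinuousOn (α i) V)
    (hβ : ∀ i, ContinuousOn (β i) V) (hα' : ∀ x ∈ V, ArePieces (Ω x) fun i => α i x)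
    (hβ' : ∀ x ∈ V, ArePieces (Ω x) fun i => β i x) :
    ∃ σ : Equiv.Perm (Fin k), ∀ i, ∀ x ∈ V, β i x = α (σ i) x := by
  rcases V.eq_empty_or_nonempty with rfl | ⟨x₀, hx₀⟩
  · exact ⟨1, by simp⟩
  have hex : ∀ x : V, ∃ σ : Equiv.Perm (Fin k), ∀ i, β i x = α (σ i) x := fun x => by
    obtain ⟨P, hP⟩ := hsplit x x.2
    exact hP.pieces_perm hm hE (hα' x x.2) (hβ' x x.2)
  choose σ hσ using hex
  have hinj : ∀ x : V, Function.Injective fun i => α i x := fun x => by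
    obtain ⟨P, hP⟩ := hsplit x x.2
    exact hP.pieces_injective hm hE (hα' x x.2)
  have hcont : Continuous fun x : V => (σ x : Fin k → Fin k) := by
    refine continuous_of_isClosed_fibers fun s => ?_
    have : (fun x : V => (σ x : Fin k → Fin k)) ⁻¹' {s} =
        ⋂ i, {x : V | β i x = α (s i) x} := by
      ext x
      simp only [mem_preimage, mem_singleton_iff, mem_iInter, mem_ofPred_eq]
      constructor
      · rintro rfl i
        exact hσ x i
      · intro h
        funext i
        exact hinj x ((hσ x i).symm.trans (h i))
    rw [this]
    exact isClosed_iInter fun i => isClosed_eq (hβ i).domRestrict (hα (s i)).domRestrict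
  have := isPreconnected_iff_preconnectedSpace.1 hV
  refine ⟨σ ⟨x₀, hx₀⟩, fun i x hx => ?_⟩
  rw [hσ ⟨x, hx⟩ i]
  have h := PreconnectedSpace.constant ‹_› hcont (x := ⟨x, hx⟩) (y := ⟨x₀, hx₀⟩)
  exact congrArg (fun s : Fin k → Fin k => α (s i) x) h

theorem eventually_eq_perm (hm : 0 < m) (hE : Module.finrank ℝ E = k * m) {V : Set E}
    (hV : IsOpen V) (hsplit : ∀ x ∈ V, ∃ P : Fin k → E →L[ℝ] E, IsSplitting (Ω x) P)
    {α β : Fin k → E → E [⋀^Fin m]→L[ℝ] ℝ} (hα : ∀ i, ContinuousOn (α i) V)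
    (hβ : ∀ i, ContinuousOn (β i) V) (hα' : ∀ x ∈ V, ArePieces (Ω x) fun i => α i x)
    (hβ' : ∀ x ∈ V, ArePieces (Ω x) fun i => β i x) {p : E} (hp : p ∈ V) :
    ∃ σ : Equiv.Perm (Fin k), ∀ᶠ x in 𝓝 p, ∀ i, β i x = α (σ i) x := by
  obtain ⟨ε, hε, hball⟩ := Metric.isOpen_iff.1 hV p hp
  obtain ⟨σ, hσ⟩ := exists_perm_of_isPreconnected hm hE (convex_ball p ε).isPreconnected
    (fun x hx => hsplit x (hball hx)) (fun i => (hα i).mono hball) (fun i => (hβ i).mono hball)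
    (fun x hx => hα' x (hball hx)) (fun x hx => hβ' x (hball hx))
  exact ⟨σ, Filter.mem_of_superset (Metric.ball_mem_nhds p hε) fun x hx i => hσ i x hx⟩

theorem exists_local_pieces (hm : 0 < m) {U : Set E} (hU : IsOpen U)
    (hΩ : ContDiffOn ℝ ∞ Ω U)
    (hsplit : ∀ x ∈ U, ∃ P : Fin k → E →L[ℝ] E, IsSplitting (Ω x) P) {p : E} (hp : p ∈ U) :
    ∃ γ : Fin k → E → E [⋀^Fin m]→L[ℝ] ℝ, ∃ W : Set E, IsOpen W ∧ p ∈ W ∧ W ⊆ U ∧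
      (∀ i, ContDiffOn ℝ ∞ (γ i) W) ∧ ∀ x ∈ W, ArePieces (Ω x) fun i => γ i x := by
  obtain ⟨P, W, hW, hpW, hWU, hP, hPW⟩ := exists_smooth_splitting hm hU hΩ hsplit hp
  exact ⟨fun i x => (Ω x).compContinuousLinearMap (P i x), W, hW, hpW, hWU,
    fun i x hx => (contDiffAt_form_comp (hΩ.contDiffAt (hU.mem_nhds (hWU hx)))
      ((hP i).contDiffAt (hW.mem_nhds hx))).contDiffWithinAt,
    fun x hx => (hPW x hx).arePieces hm⟩

/-- The space of the pairs of a point of `V` and an ordered decomposition at this point. -/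
abbrev PieceSpace (k : ℕ) (V : Set E) (Ω : E → E [⋀^Fin m]→L[ℝ] ℝ) : Type _ :=
  {q : V × (Fin k → E [⋀^Fin m]→L[ℝ] ℝ) // ArePieces (Ω q.1) q.2}

/-- The base point of an ordered decomposition. -/
def PieceSpace.proj {V : Set E} (q : PieceSpace k V Ω) : V := q.1.1

/-- A local smooth decomposition `γ` trivializes the projection: every ordered decomposition over
its domain is a unique reordering of `γ`, and the reordering depends continuously on the point. -/
theorem isCoveringMap_proj (hm : 0 < m) (hE : Module.finrank ℝ E = k * m) {V : Set E}
    (hV : IsOpen V) (hΩ : ContDiffOn ℝ ∞ Ω V)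
    (hsplit : ∀ x ∈ V, ∃ P : Fin k → E →L[ℝ] E, IsSplitting (Ω x) P) :
    IsCoveringMap (PieceSpace.proj : PieceSpace k V Ω → V) := by
  intro x
  refine IsEvenlyCovered.to_isEvenlyCovered_preimage
    (I := {s : Fin k → Fin k // Function.Bijective s}) ⟨inferInstance, ?_⟩
  obtain ⟨γ, W, hW, hxW, hWV, hγ, hγW⟩ := exists_local_pieces hm hV hΩ hsplit x.2
  have hproj : Continuous (PieceSpace.proj : PieceSpace k V Ω → V) :=
    continuous_fst.comp continuous_subtype_val
  have hWo : IsOpen (Subtype.val ⁻¹' W : Set V) := hW.preimage continuous_subtype_val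
  refine ⟨(Subtype.val ⁻¹' W : Set V), hxW, hWo, hWo.preimage hproj, ?_⟩
  have hinj : ∀ y ∈ W, Function.Injective fun i => γ i y := fun y hy => by
    obtain ⟨P, hP⟩ := hsplit y (hWV hy)
    exact hP.pieces_injective hm hE (hγW y hy)
  have hex : ∀ q : (PieceSpace.proj : PieceSpace k V Ω → V) ⁻¹' (Subtype.val ⁻¹' W : Set V),
      ∃ s : {s : Fin k → Fin k // Function.Bijective s}, ∀ i, q.1.1.2 i = γ (s.1 i) q.1.1.1 := by
    intro q
    obtain ⟨P, hP⟩ := hsplit q.1.1.1 q.1.1.1.2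
    obtain ⟨σ, hσ⟩ := hP.pieces_perm hm hE (hγW q.1.1.1 q.2) q.1.2
    exact ⟨⟨σ, σ.bijective⟩, hσ⟩
  choose s hs using hex
  have hscont : Continuous s := by
    refine continuous_of_isClosed_fibers fun t => ?_
    have : s ⁻¹' {t} = ⋂ i, {q | q.1.1.2 i = γ (t.1 i) q.1.1.1} := by
      ext q
      simp only [mem_preimage, mem_singleton_iff, mem_iInter, mem_ofPred_eq]
      constructor
      · rintro rfl i
        exact hs q i
      · intro h
        refine Subtype.ext (funext fun i => ?_)
        exact hinj _ q.2 ((hs q i).symm.trans (h i))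
    rw [this]
    refine isClosed_iInter fun i => isClosed_eq (by fun_prop) ?_
    exact (hγ (t.1 i)).continuousOn.comp_continuous (by fun_prop) fun q => q.2
  refine ⟨⟨⟨fun q => (⟨q.1.proj, q.2⟩, s q),
    fun y => ⟨⟨(y.1.1, fun i => γ (y.2.1 i) y.1.1), (hγW _ y.1.2).permute y.2.2⟩, y.1.2⟩,
    fun q => ?_, fun y => ?_⟩, ?_, ?_⟩, fun q => rfl⟩
  · exact Subtype.ext (Subtype.ext (Prod.ext rfl (funext fun i => (hs q i).symm)))
  · refine Prod.ext rfl (Subtype.ext (funext fun i => ?_))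
    exact hinj _ y.1.2 (hs ⟨⟨(y.1.1, fun i => γ (y.2.1 i) y.1.1), _⟩, y.1.2⟩ i).symm
  · exact ((hproj.comp continuous_subtype_val).subtype_mk _).prodMk hscont
  · refine Continuous.subtype_mk (Continuous.subtype_mk (Continuous.prodMk (by fun_prop)
      (continuous_pi fun i => ?_)) _) _
    rw [continuous_prod_of_discrete_right]
    intro t
    exact (hγ (t.1 i)).continuousOn.comp_continuous (by fun_prop) fun y => y.2

theorem exists_rankDecomposition (hm : 0 < m) (hE : Module.finrank ℝ E = k * m) {V : Set E}
    (hV : IsOpen V) (hV' : IsSimplyConnected V) (hΩ : ContDiffOn ℝ ∞ Ω V)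
    (hsplit : ∀ x ∈ V, ∃ P : Fin k → E →L[ℝ] E, IsSplitting (Ω x) P) :
    ∃ α : Fin k → E → E [⋀^Fin m]→L[ℝ] ℝ, IsRankDecomposition V Ω α := by
  classical
  have := hV'.simplyConnectedSpace
  have := hV.locallyPathConnectedSpace
  obtain ⟨x₀, hx₀⟩ := hV'.nonempty
  obtain ⟨P, hP⟩ := hsplit x₀ hx₀
  obtain ⟨F, ⟨-, hF⟩, -⟩ :=
    (isCoveringMap_proj hm hE hV hΩ hsplit).existsUnique_continuousMap_lifts (ContinuousMap.id V)
      ⟨x₀, hx₀⟩ ⟨(⟨x₀, hx₀⟩, _), hP.arePieces hm⟩ rfl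
  have hF' : ∀ x : V, (F x).1.1 = x := fun x => congrFun hF x
  let α : Fin k → E → E [⋀^Fin m]→L[ℝ] ℝ := fun i x => if h : x ∈ V then (F ⟨x, h⟩).1.2 i else 0
  have hα : ∀ i x (h : x ∈ V), α i x = (F ⟨x, h⟩).1.2 i := fun i x h => dif_pos h
  have hpieces : ∀ x ∈ V, ArePieces (Ω x) fun i => α i x := fun x hx => by
    have h1 := (F ⟨x, hx⟩).2
    rw [hF'] at h1
    simp_rw [hα _ x hx]
    exact h1
  have hcont : ∀ i, ContinuousOn (α i) V := fun i => by
    rw [continuousOn_iff_continuous_domRestrict]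
    have : V.domRestrict (α i) = fun x : V => (F x).1.2 i := funext fun x => hα i x x.2
    rw [this]
    fun_prop
  refine ⟨α, ⟨fun i x hx => ?_, fun i x hx => (hpieces x hx).1 i, fun x hx => (hpieces x hx).2⟩⟩
  -- The lift is only continuous. Near `x` it is a fixed reordering of a smooth decomposition, and
  -- so it is smooth.
  obtain ⟨γ, W, hW, hxW, hWV, hγ, hγW⟩ := exists_local_pieces hm hV hΩ hsplit hx
  obtain ⟨σ, hσ⟩ := eventually_eq_perm hm hE hW (fun y hy => hsplit y (hWV hy))
    (fun i => (hγ i).continuousOn) (fun i => (hcont i).mono hWV) hγW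
    (fun y hy => hpieces y (hWV hy)) hxW
  exact (((hγ (σ i)).contDiffAt (hW.mem_nhds hxW)).congr_of_eventuallyEq
    (hσ.mono fun y hy => hy i)).contDiffWithinAt

end Pieces
end ProductForms
end

noncomputable section
open scoped ContDiff Topology
open Filter Set

namespace ProductForms

/-! ### Smooth dependence of flows, by the implicit function theorem on a path space -/

section PathSpace

universe u

/-- Pointwise application of operator-valued functions. -/
def pointwiseApply (I : Type*) [TopologicalSpace I] [CompactSpace I] (F G : Type*)
    [NormedAddCommGroup F] [NormedSpace ℝ F] [NormedAddCommGroup G] [NormedSpace ℝ G] :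
    C(I, F →L[ℝ] G) →L[ℝ] C(I, F) →L[ℝ] C(I, G) :=
  LinearMap.mkContinuous₂
    (LinearMap.mk₂ ℝ (fun (A : C(I, F →L[ℝ] G)) (h : C(I, F)) => (⟨fun t => A t (h t), by fun_prop⟩ : C(I, G)))
      (fun A B h => by ext; simp) (fun c A h => by ext; simp)
      (fun A h h' => by ext; simp) (fun c A h => by ext; simp)) 1 fun A h => by
    rw [one_mul]
    refine (ContinuousMap.norm_le _ (by positivity)).2 fun t => ?_
    exact ((A t).le_opNorm _).trans (mul_le_mul (A.norm_coe_le_norm t) (h.norm_coe_le_norm t)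
      (norm_nonneg (h t)) (norm_nonneg A))

/-- Composition with a continuous function, on spaces of continuous functions. -/
def postcomp (I : Type*) [TopologicalSpace I] {F G : Type*} [TopologicalSpace F]
    [TopologicalSpace G] (f : C(F, G)) (γ : C(I, F)) : C(I, G) := f.comp γ

variable {I : Type*} [TopologicalSpace I] [CompactSpace I]

/-- The range of `γ` is compact, so the derivative of `f` is uniformly continuous near it and the
mean value inequality bounds the remainder uniformly in `t`. -/
theorem hasFDerivAt_postcomp {F G : Type*} [NormedAddCommGroup F] [NormedSpace ℝ F]
    [NormedAddCommGroup G] [NormedSpace ℝ G] {f : C(F, G)} (hf : ContDiff ℝ 1 f) (γ : C(I, F)) :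
    HasFDerivAt (postcomp I f)
      (pointwiseApply I F G (postcomp I ⟨fderiv ℝ f, hf.continuous_fderiv one_ne_zero⟩ γ)) γ := by
  rw [hasFDerivAt_iff_isLittleO_nhds_zero, Asymptotics.isLittleO_iff]
  intro ε hε
  have hunif := (isCompact_range γ.continuous).uniformContinuousAt_of_continuousAt (fderiv ℝ f)
    (fun x _ => (hf.continuous_fderiv one_ne_zero).continuousAt) (Metric.dist_mem_uniformity hε)
  obtain ⟨δ, hδ, hδε⟩ := Metric.mem_uniformity_dist.1 hunif
  filter_upwards [Metric.ball_mem_nhds (0 : C(I, F)) hδ] with h hh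
  rw [mem_ball_zero_iff] at hh
  refine (ContinuousMap.norm_le _ (by positivity)).2 fun t => ?_
  have hht : ‖h t‖ < δ := (h.norm_coe_le_norm t).trans_lt hh
  have key : ‖f (γ t + h t) - f (γ t) - fderiv ℝ f (γ t) (γ t + h t - γ t)‖ ≤
      ε * ‖γ t + h t - γ t‖ := by
    refine (convex_ball (γ t) δ).norm_image_sub_le_of_norm_fderiv_le' (𝕜 := ℝ)
      (fun x _ => (hf.differentiable one_ne_zero) x) (fun x hx => ?_) (Metric.mem_ball_self hδ) ?_
    · have := hδε (a := γ t) (b := x) (by rwa [dist_comm]) (mem_range_self t)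
      rw [← dist_eq_norm, dist_comm]
      exact le_of_lt this
    · rw [Metric.mem_ball, dist_eq_norm, add_sub_cancel_left]
      exact hht
  rw [add_sub_cancel_left] at key
  exact key.trans (mul_le_mul_of_nonneg_left (h.norm_coe_le_norm t) hε.le)

/-- The derivative is postcomposition with `fderiv ℝ f`, followed by a continuous linear map. The
induction changes the codomain from `G` to `F →L[ℝ] G`, which is why `F` and `G` share a universe.
-/
theorem contDiff_postcomp_nat {F : Type u} [NormedAddCommGroup F] [NormedSpace ℝ F] (n : ℕ) :
    ∀ {G : Type u} [NormedAddCommGroup G] [NormedSpace ℝ G] {f : C(F, G)},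
      ContDiff ℝ n f → ContDiff ℝ n (postcomp I f) := by
  induction n with
  | zero =>
    intro G _ _ f hf
    exact contDiff_zero.2 (ContinuousMap.continuous_postcomp _)
  | succ n ih =>
    intro G _ _ f hf
    have hf1 : ContDiff ℝ 1 f := hf.of_le (by exact_mod_cast Nat.le_add_left 1 n)
    have hd : ContDiff ℝ n (fderiv ℝ f) := hf.fderiv_right (by norm_cast)
    rw [Nat.cast_add, Nat.cast_one, contDiff_succ_iff_fderiv]
    refine ⟨fun γ => (hasFDerivAt_postcomp hf1 γ).differentiableAt, by simp, ?_⟩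
    have : fderiv ℝ (postcomp I f) =
        fun γ => pointwiseApply I F G (postcomp I ⟨fderiv ℝ f, hd.continuous⟩ γ) :=
      funext fun γ => (hasFDerivAt_postcomp hf1 γ).fderiv
    rw [this]
    exact (pointwiseApply I F G).contDiff.comp (ih (f := ⟨fderiv ℝ f, hd.continuous⟩) hd)

theorem contDiff_postcomp {F G : Type u} [NormedAddCommGroup F] [NormedSpace ℝ F]
    [NormedAddCommGroup G] [NormedSpace ℝ G] {f : C(F, G)} (hf : ContDiff ℝ ∞ f) :
    ContDiff ℝ ∞ (postcomp I f) :=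
  contDiff_infty.2 fun n => contDiff_postcomp_nat n (hf.of_le (by exact_mod_cast le_top))

theorem continuous_IccExtend_unit {G : Type*} [TopologicalSpace G] (g : C(unitInterval, G)) :
    Continuous (IccExtend (zero_le_one (α := ℝ)) g) := g.continuous.Icc_extend'

/-- The primitive that vanishes at `0`. -/
def primitiveCLM (G : Type*) [NormedAddCommGroup G] [NormedSpace ℝ G] :
    C(unitInterval, G) →L[ℝ] C(unitInterval, G) :=
  LinearMap.mkContinuous
    { toFun := fun g => ⟨fun s => ∫ r in (0 : ℝ)..s, IccExtend (zero_le_one (α := ℝ)) g r,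
        (intervalIntegral.continuous_primitive
          (fun a b => (continuous_IccExtend_unit g).intervalIntegrable a b) 0).comp
          continuous_subtype_val⟩
      map_add' := fun g h => by
        ext s
        exact intervalIntegral.integral_add
          ((continuous_IccExtend_unit g).intervalIntegrable _ _)
          ((continuous_IccExtend_unit h).intervalIntegrable _ _)
      map_smul' := fun c g => by
        ext s
        exact intervalIntegral.integral_smul c _ } 1 fun g => by
    rw [one_mul]
    refine (ContinuousMap.norm_le _ (norm_nonneg _)).2 fun s => ?_
    refine (intervalIntegral.norm_integral_le_of_norm_le_const (C := ‖g‖)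
      fun r _ => g.norm_coe_le_norm _).trans ?_
    rw [sub_zero, abs_of_nonneg s.2.1]
    exact mul_le_of_le_one_right (norm_nonneg _) s.2.2

theorem primitiveCLM_apply {G : Type*} [NormedAddCommGroup G] [NormedSpace ℝ G] (g : C(unitInterval, G)) (s : unitInterval) :
    primitiveCLM G g s = ∫ r in (0 : ℝ)..s, IccExtend (zero_le_one (α := ℝ)) g r := rfl

/-- The smooth dependence on `y` and `t` of the solution at time `1` of `z' = K z t`, `z 0 = y`,
near a constant solution. -/
theorem exists_flow {E T : Type u} [NormedAddCommGroup E] [NormedSpace ℝ E] [CompleteSpace E]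
    [NormedAddCommGroup T] [NormedSpace ℝ T] [CompleteSpace T] {K : E → T →L[ℝ] E}
    (hK : ContDiff ℝ ∞ K) (p : E) :
    ∃ F : E × T → E, ∃ ρ > 0, ContDiffOn ℝ ∞ F (Metric.ball p ρ ×ˢ Metric.ball 0 ρ) ∧
      (∀ y ∈ Metric.ball p ρ, F (y, 0) = y) ∧
      ∀ y ∈ Metric.ball p ρ, ∀ t ∈ Metric.ball (0 : T) ρ, ∀ s ∈ Icc (0 : ℝ) 1,
        HasDerivWithinAt (fun s : ℝ => F (y, s • t)) (K (F (y, s • t)) t) (Icc 0 1) s := by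
  let Y : C(E × T, E) := ⟨fun q => K q.1 q.2, by have := hK.continuous; fun_prop⟩
  have hY : ContDiff ℝ ∞ Y := (hK.comp contDiff_fst).clm_apply contDiff_snd
  let ι : C(unitInterval, E) →L[ℝ] C(unitInterval, E × T) :=
    (ContinuousLinearMap.inl ℝ E T).compLeftContinuous ℝ unitInterval
  let κ : T →L[ℝ] C(unitInterval, E × T) :=
    ContinuousLinearMap.const ℝ unitInterval ∘L ContinuousLinearMap.inr ℝ E T
  let J := primitiveCLM E
  let c : E →L[ℝ] C(unitInterval, E) := ContinuousLinearMap.const ℝ unitInterval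
  -- The zeros of `Ψ` are the solutions of the integral equation `γ s = y + ∫ K (γ r) t`. For `t =
  -- 0` the integral vanishes, so the derivative in `γ` is the identity.
  let Ψ : (E × T) × C(unitInterval, E) → C(unitInterval, E) := fun q =>
    q.2 - c q.1.1 - J (postcomp unitInterval Y (ι q.2 + κ q.1.2))
  have hΨ : ContDiff ℝ ∞ Ψ := by
    refine (contDiff_snd.sub (c.contDiff.comp contDiff_fst.fst)).sub (J.contDiff.comp
      ((contDiff_postcomp hY).comp ((ι.contDiff.comp contDiff_snd).add
        (κ.contDiff.comp contDiff_fst.snd))))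
  have hval : ∀ γ t (r : unitInterval),
      postcomp unitInterval Y (ι γ + κ t) r = K (γ r) t := fun γ t r => by
    simp [postcomp, Y, ι, κ]
  have hzero : ∀ γ, postcomp unitInterval Y (ι γ + κ 0) = 0 := fun γ => by
    ext r
    rw [hval]
    simp
  have hΨ0 : ∀ γ, Ψ ((p, 0), γ) = γ - c p := fun γ => by
    change γ - c p - J (postcomp unitInterval Y (ι γ + κ 0)) = _
    rw [hzero, map_zero, sub_zero]
  have hd : HasFDerivAt (fun γ => Ψ ((p, 0), γ))
      ((ContinuousLinearEquiv.refl ℝ C(unitInterval, E) : _ ≃L[ℝ] _) :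
        C(unitInterval, E) →L[ℝ] C(unitInterval, E)) (c p) := by
    simp_rw [hΨ0]
    exact (hasFDerivAt_id _).sub_const _
  obtain ⟨Γ, W, hW, hpW, hΓ, hΓp, hΓW, huniq⟩ := exists_smooth_implicit isOpen_univ
    hΨ.contDiffOn (x₀ := ((p, 0) : E × T)) (y₀ := c p) trivial (by rw [hΨ0, sub_self]) hd
  have hΓcont : ContinuousAt Γ (p, 0) := hΓ.continuousOn.continuousAt (hW.mem_nhds hpW)
  rw [nhds_prod_eq, eventually_prod_iff] at huniq
  obtain ⟨A, hA, B, hB, huniq⟩ := huniq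
  obtain ⟨r, hr, hBr⟩ := Metric.eventually_nhds_iff_ball.1 hB
  have hev : ∀ᶠ q in 𝓝 ((p, 0) : E × T), q ∈ W ∧ A q ∧ Γ q ∈ Metric.ball (c p) r := by
    refine (hW.eventually_mem hpW).and (hA.and (hΓcont.eventually_mem ?_))
    rw [hΓp]
    exact Metric.ball_mem_nhds _ hr
  obtain ⟨ρ, hρ, hball⟩ := Metric.eventually_nhds_iff_ball.1 hev
  rw [← ball_prod_same] at hball
  have hint : ∀ q ∈ W, ∀ s : unitInterval, Γ q s = q.1 + ∫ r in (0 : ℝ)..s,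
      IccExtend (zero_le_one (α := ℝ)) (fun r => K (Γ q r) q.2) r := by
    intro q hq s
    have h0 := congrArg (fun g : C(unitInterval, E) => g s) (hΓW q hq).2
    have h1 : Γ q s - q.1 - J (postcomp unitInterval Y (ι (Γ q) + κ q.2)) s = 0 := h0
    rw [sub_sub, sub_eq_zero] at h1
    rw [h1]
    congr 1
    change ∫ r in (0 : ℝ)..s, IccExtend (zero_le_one (α := ℝ))
      (postcomp unitInterval Y (ι (Γ q) + κ q.2)) r = _
    congr 1
    funext r
    exact hval _ _ _
  -- Running the solution for `t` at speed `s` solves the equation for `s • t`. The slowed curve is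
  -- no farther from the constant `p`, so local uniqueness applies to it.
  have hscale : ∀ y ∈ Metric.ball p ρ, ∀ t ∈ Metric.ball (0 : T) ρ, ∀ s : unitInterval,
      Γ (y, (s : ℝ) • t) 1 = Γ (y, t) s := by
    intro y hy t ht s
    have hst : (s : ℝ) • t ∈ Metric.ball (0 : T) ρ := by
      rw [mem_ball_zero_iff] at ht ⊢
      rw [norm_smul, Real.norm_of_nonneg s.2.1]
      exact (mul_le_of_le_one_left (norm_nonneg _) s.2.2).trans_lt ht
    obtain ⟨h1, h2, h3⟩ := hball (y, t) ⟨hy, ht⟩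
    obtain ⟨h4, h5, h6⟩ := hball (y, (s : ℝ) • t) ⟨hy, hst⟩
    let γ : C(unitInterval, E) := (Γ (y, t)).comp ⟨fun r => s * r, by fun_prop⟩
    have hγ : ∀ r, γ r = Γ (y, t) (s * r) := fun r => rfl
    have hγball : γ ∈ Metric.ball (c p) r := by
      rw [mem_ball_iff_norm] at h3 ⊢
      refine lt_of_le_of_lt ((ContinuousMap.norm_le _ (norm_nonneg _)).2 fun r => ?_) h3
      exact (Γ (y, t) - c p).norm_coe_le_norm (s * r)
    have hsol : Ψ ((y, (s : ℝ) • t), γ) = 0 := by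
      ext r
      change γ r - y - ∫ u in (0 : ℝ)..r, IccExtend (zero_le_one (α := ℝ))
        (postcomp unitInterval Y (ι γ + κ ((s : ℝ) • t))) u = 0
      rw [hγ, hint _ h1, sub_sub, sub_eq_zero]
      congr 1
      have hs := intervalIntegral.smul_integral_comp_mul_left (a := 0) (b := (r : ℝ))
        (IccExtend (zero_le_one (α := ℝ)) (fun r => K (Γ (y, t) r) t)) (s : ℝ)
      rw [mul_zero] at hs
      rw [show ((s * r : unitInterval) : ℝ) = s * r from rfl, ← hs,
        ← intervalIntegral.integral_smul]
      refine intervalIntegral.integral_congr fun u hu => ?_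
      rw [uIcc_of_le r.2.1] at hu
      have hu' : u ∈ Icc (0 : ℝ) 1 := ⟨hu.1, hu.2.trans r.2.2⟩
      have hsu : (s : ℝ) * u ∈ Icc (0 : ℝ) 1 := unitInterval.mul_mem s.2 hu'
      rw [IccExtend_of_mem _ _ hu', IccExtend_of_mem _ _ hsu, hval, map_smul]
      rfl
    have := huniq h5 (hBr γ hγball) hsol
    rw [← show γ = Γ (y, (s : ℝ) • t) from this, hγ, mul_one]
  have hFs : ∀ y ∈ Metric.ball p ρ, ∀ t ∈ Metric.ball (0 : T) ρ, ∀ s ∈ Icc (0 : ℝ) 1,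
      Γ (y, s • t) 1 = y + ∫ r in (0 : ℝ)..s,
        IccExtend (zero_le_one (α := ℝ)) (fun r => K (Γ (y, t) r) t) r := fun y hy t ht s hs => by
    rw [hscale y hy t ht ⟨s, hs⟩, hint _ (hball (y, t) ⟨hy, ht⟩).1]
  refine ⟨fun q => Γ q 1, ρ, hρ, ?_, fun y hy => ?_, fun y hy t ht s hs => ?_⟩
  · exact (ContinuousMap.evalCLM ℝ (1 : unitInterval)).contDiff.comp_contDiffOn
      (hΓ.mono fun q hq => (hball q hq).1)
  · have h := hFs y hy 0 (Metric.mem_ball_self hρ) 0 (by simp)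
    simpa using h
  · have hc : Continuous fun r : unitInterval => K (Γ (y, t) r) t := by
      have := hK.continuous
      fun_prop
    have h1 := ((hc.Icc_extend' (h := zero_le_one (α := ℝ))).integral_hasStrictDerivAt 0
      s).hasDerivAt.const_add y
    rw [IccExtend_of_mem _ _ hs] at h1
    change HasDerivWithinAt (fun s : ℝ => Γ (y, s • t) 1) (K (Γ (y, s • t) 1) t) (Icc 0 1) s
    rw [show Γ (y, s • t) 1 = Γ (y, t) ⟨s, hs⟩ from hscale y hy t ht ⟨s, hs⟩]
    exact h1.hasDerivWithinAt.congr (fun s' hs' => hFs y hy t ht s' hs') (hFs y hy t ht s hs)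

end PathSpace
end ProductForms
end

noncomputable section
open scoped ContDiff Topology
open Filter Set

namespace ProductForms

/-! ### Homotopies along the kernel of a closed form -/

section Homotopy

variable {E F : Type*} [NormedAddCommGroup E] [NormedSpace ℝ E]
  [NormedAddCommGroup F] [NormedSpace ℝ F] {m : ℕ}

theorem form_eq_zero_of_mem_formKernel {η : F [⋀^Fin m]→L[ℝ] ℝ} {w : Fin m → F} {i : Fin m}
    (h : w i ∈ formKernel η) : η w = 0 := by
  have := h w i
  rwa [Function.update_eq_self] at this

theorem extDeriv_pullback_eq_zero {V : Set F} (hV : IsOpen V) {α : F → F [⋀^Fin m]→L[ℝ] ℝ}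
    (hα : ContDiffOn ℝ ∞ α V) (hdα : IsClosedForm V α) {G : E → F} {x : E}
    (hG : ContDiffAt ℝ ∞ G x) (hx : G x ∈ V) :
    extDeriv (fun y => (α (G y)).compContinuousLinearMap (fderiv ℝ G y)) x = 0 := by
  rw [extDeriv_pullback (r := ∞) ((hα.contDiffAt (hV.mem_nhds hx)).differentiableAt (by simp)) hG
    (by rw [minSmoothness_of_isRCLikeNormedField]; exact WithTop.coe_le_coe.2 (le_top (a := (2 : ℕ∞)))), hdα _ hx]
  ext v
  simp

variable [FiniteDimensional ℝ E] [FiniteDimensional ℝ F]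

/-- Pullbacks of a closed form along a homotopy that moves points in the kernel of the form. -/
theorem pullback_eq_of_homotopy {V : Set F} (hV : IsOpen V) {α : F → F [⋀^Fin m]→L[ℝ] ℝ}
    (hα : ContDiffOn ℝ ∞ α V) (hdα : IsClosedForm V α) {G : ℝ × E → F} {O : Set (ℝ × E)}
    (hO : IsOpen O) (hG : ContDiffOn ℝ ∞ G O) (hGV : MapsTo G O V)
    (hker : ∀ q ∈ O, q.1 ∈ Ioo (0 : ℝ) 1 → fderiv ℝ G q (1, 0) ∈ formKernel (α (G q)))
    {x : E} (hx : ∀ s ∈ Icc (0 : ℝ) 1, (s, x) ∈ O) (v : Fin m → E) :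
    α (G (1, x)) (fun i => fderiv ℝ G (1, x) (0, v i)) =
      α (G (0, x)) (fun i => fderiv ℝ G (0, x) (0, v i)) := by
  let β : ℝ × E → (ℝ × E) [⋀^Fin m]→L[ℝ] ℝ :=
    fun q => (α (G q)).compContinuousLinearMap (fderiv ℝ G q)
  have hβ : ∀ q ∈ O, ContDiffAt ℝ ∞ β q := fun q hq => by
    have hGq := hG.contDiffAt (hO.mem_nhds hq)
    exact contDiffAt_form_comp ((hα.contDiffAt (hV.mem_nhds (hGV hq))).comp q hGq)
      (hGq.fderiv_right (by simp))
  have hdβ : ∀ q ∈ O, extDeriv β q = 0 := fun q hq =>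
    extDeriv_pullback_eq_zero hV hα hdα (hG.contDiffAt (hO.mem_nhds hq)) (hGV hq)
  let v' : Fin m → ℝ × E := fun i => (0, v i)
  have hderiv : ∀ s ∈ Ioo (0 : ℝ) 1, HasDerivAt (fun s => β (s, x) v') 0 s := by
    intro s hs
    have hsO : (s, x) ∈ O := hx s ⟨hs.1.le, hs.2.le⟩
    have hdiff := (hβ _ hsO).differentiableAt (by simp)
    have h0 : extDeriv β (s, x) (Fin.cons (1, 0) v') = 0 := by
      rw [hdβ _ hsO]
      rfl
    rw [extDeriv_apply hdiff, Fin.sum_univ_succ] at h0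
    -- In `dβ = 0`, evaluated on the time direction and `v'`, every term but one keeps the time
    -- direction as an argument of `β`. Those terms differentiate a function that vanishes near the
    -- point; the remaining one is the time derivative of `β v'`.
    have hrest : ∀ j : Fin m, fderiv ℝ (fun q => β q (j.succ.removeNth
        (Fin.cons (1, 0) v' : Fin (m + 1) → ℝ × E))) (s, x) = 0 := by
      intro j
      have hev : (fun q => β q (j.succ.removeNth (Fin.cons (1, 0) v' : Fin (m + 1) → ℝ × E)))
          =ᶠ[𝓝 (s, x)] fun _ => 0 := by
        have hS : IsOpen (O ∩ Prod.fst ⁻¹' Ioo (0 : ℝ) 1) :=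
          hO.inter (isOpen_Ioo.preimage continuous_fst)
        filter_upwards [hS.mem_nhds ⟨hsO, hs⟩] with q hq
        have : NeZero m := ⟨by have := j.2; omega⟩
        change α (G q) (fun i => fderiv ℝ G q
          (j.succ.removeNth (Fin.cons (1, 0) v' : Fin (m + 1) → ℝ × E) i)) = 0
        refine form_eq_zero_of_mem_formKernel (i := 0) ?_
        have : j.succ.removeNth (Fin.cons (1, 0) v' : Fin (m + 1) → ℝ × E) 0 = (1, 0) := by
          rw [Fin.removeNth_apply, Fin.succ_succAbove_zero, Fin.cons_zero]
        rw [this]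
        exact hker q hq.1 hq.2
      rw [hev.fderiv_eq]
      simp
    simp only [hrest, zero_apply, smul_zero, Finset.sum_const_zero, add_zero, Fin.removeNth_zero,
      Fin.tail_cons, Fin.cons_zero, Fin.val_zero, pow_zero, one_smul] at h0
    have hd2 : HasFDerivAt (fun q => β q v') (fderiv ℝ (fun q => β q v') (s, x)) (s, x) :=
      ((contDiffAt_form_apply_const (hβ _ hsO) v').differentiableAt (by simp)).hasFDerivAt
    have hd3 : HasDerivAt (fun s : ℝ => (s, x)) ((1 : ℝ), (0 : E)) s :=
      (hasDerivAt_id s).prodMk (hasDerivAt_const s x)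
    have := hd2.comp_hasDerivAt s hd3
    rwa [h0] at this
  have hcont : ContinuousOn (fun s => β (s, x) v') (Icc 0 1) := fun s hs =>
    ((contDiffAt_form_apply_const (hβ _ (hx s hs)) v').continuousAt.comp
      (f := fun s : ℝ => (s, x)) (by fun_prop)).continuousWithinAt
  obtain ⟨c, hc, hslope⟩ := exists_hasDerivAt_eq_slope (fun s => β (s, x) v') (fun _ => 0)
    one_pos hcont hderiv
  rw [sub_zero, div_one] at hslope
  exact sub_eq_zero.1 hslope.symm

theorem exists_contDiff_eventuallyEq {G : Type*} [NormedAddCommGroup G] [NormedSpace ℝ G]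
    {V : Set E} (hV : IsOpen V) {f : E → G} (hf : ContDiffOn ℝ ∞ f V) {p : E} (hp : p ∈ V) :
    ∃ g : E → G, ContDiff ℝ ∞ g ∧ g =ᶠ[𝓝 p] f := by
  obtain ⟨ε, hε, hball⟩ := Metric.nhds_basis_closedBall.mem_iff.1 (hV.mem_nhds hp)
  let φ : ContDiffBump p := ⟨ε / 2, ε, by positivity, by linarith⟩
  refine ⟨fun x => φ x • f x, contDiff_iff_contDiffAt.2 fun x => ?_, ?_⟩
  · by_cases hx : x ∈ V
    · exact (φ.contDiff.contDiffAt).smul (hf.contDiffAt (hV.mem_nhds hx))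
    · have hx' : x ∈ (Metric.closedBall p ε)ᶜ := fun h => hx (hball h)
      refine (contDiffAt_const (c := (0 : G))).congr_of_eventuallyEq ?_
      filter_upwards [Metric.isClosed_closedBall.isOpen_compl.mem_nhds hx'] with y hy
      rw [φ.zero_of_le_dist (le_of_lt (by simpa using hy)), zero_smul]
  · filter_upwards [φ.eventuallyEq_one] with x hx
    rw [hx]
    simp

end Homotopy

/-! ### Reduction of a closed form to a slice transverse to its kernel -/

section Slice

universe u

variable {E : Type u} [NormedAddCommGroup E] [NormedSpace ℝ E] [FiniteDimensional ℝ E] {m : ℕ}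

/-- Write `x` as a point `δ x` of the slice through `p` plus a displacement `τ x`. The map `H`
starts at `δ x` and follows the field `κ · (τ x)` for time `1`. Shrinking the displacement to `0`
moves points along the kernel, so `H` and `δ` pull `α` back to the same form; as `H` is a local
diffeomorphism, `f = δ ∘ H⁻¹` pulls `α` back to itself. The kernels need not be integrated to
leaves. -/
theorem exists_pullback_from_slice {V : Set E} (hV : IsOpen V) {α : E → E [⋀^Fin m]→L[ℝ] ℝ}
    (hα : ContDiffOn ℝ ∞ α V) (hdα : IsClosedForm V α) {κ : E → E →L[ℝ] E}
    (hκ : ContDiffOn ℝ ∞ κ V) (hker : ∀ x ∈ V, ∀ t, κ x t ∈ formKernel (α x)) {p : E}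
    (hp : p ∈ V) (hκp : κ p * κ p = κ p) :
    ∃ f : E → E, ∃ W : Set E, IsOpen W ∧ p ∈ W ∧ W ⊆ V ∧ ContDiffOn ℝ ∞ f W ∧ f p = p ∧
      ∀ x ∈ W, f x ∈ V ∧ κ p (f x - p) = 0 ∧
        α x = (α (f x)).compContinuousLinearMap (fderiv ℝ f x) := by
  have := FiniteDimensional.complete ℝ E
  obtain ⟨K, hK, hKκ⟩ := exists_contDiff_eventuallyEq hV hκ hp
  obtain ⟨V₁, hV₁, hV₁o, hpV₁⟩ := eventually_nhds_iff.1 (hKκ.and (hV.eventually_mem hp))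
  obtain ⟨F, ρ, hρ, hF, hF0, hFd⟩ := exists_flow hK p
  have hKp : K p = κ p := (hV₁ p hpV₁).1
  have hκκ : ∀ v, κ p (κ p v) = κ p v := fun v => congrArg (fun A : E →L[ℝ] E => A v) hκp
  let S := Metric.ball p ρ ×ˢ Metric.ball (0 : E) ρ
  have hS : IsOpen S := Metric.isOpen_ball.prod Metric.isOpen_ball
  let δ : E → E := fun x => x - κ p (x - p)
  have hδ : ContDiff ℝ ∞ δ := contDiff_id.sub ((κ p).contDiff.comp (contDiff_id.sub contDiff_const))
  have hδ' : ∀ x, HasFDerivAt δ (1 - κ p) x := fun x =>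
    (hasFDerivAt_id x).sub ((κ p).hasFDerivAt.comp x ((hasFDerivAt_id x).sub_const p))
  let τ : E → E := fun x => κ p (x - p)
  have hτ : ContDiff ℝ ∞ τ := (κ p).contDiff.comp (contDiff_id.sub contDiff_const)
  have hτ' : ∀ x, HasFDerivAt τ (κ p) x := fun x =>
    (κ p).hasFDerivAt.comp x ((hasFDerivAt_id x).sub_const p)
  have hδp : δ p = p := by simp [δ]
  have hτp : τ p = 0 := by simp [τ]
  let μ : ℝ × E → E × E := fun q => (δ q.2, q.1 • τ q.2)
  have hμ : ContDiff ℝ ∞ μ := (hδ.comp contDiff_snd).prodMk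
    (contDiff_fst.smul (hτ.comp contDiff_snd))
  let G : ℝ × E → E := fun q => F (μ q)
  -- The flow equation in `s` requires `τ x` itself, not only `s • τ x`, to lie in the ball.
  let O₁ : Set (ℝ × E) := μ ⁻¹' S ∩ Prod.snd ⁻¹' (τ ⁻¹' Metric.ball 0 ρ)
  have hO₁ : IsOpen O₁ := (hS.preimage hμ.continuous).inter
    ((Metric.isOpen_ball.preimage hτ.continuous).preimage continuous_snd)
  have hG₁ : ContDiffOn ℝ ∞ G O₁ := hF.comp hμ.contDiffOn fun q hq => hq.1
  let O := O₁ ∩ G ⁻¹' V₁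
  have hO : IsOpen O := hG₁.continuousOn.isOpen_inter_preimage hO₁ hV₁o
  have hG : ContDiffOn ℝ ∞ G O := hG₁.mono inter_subset_left
  have hGV : MapsTo G O V := fun q hq => (hV₁ _ hq.2).2
  have hpS : ∀ s : ℝ, μ (s, p) = (p, 0) := fun s => by simp [μ, hδp, hτp]
  have hpρ : p ∈ Metric.ball p ρ := Metric.mem_ball_self hρ
  have h0ρ : (0 : E) ∈ Metric.ball 0 ρ := Metric.mem_ball_self hρ
  have hpO : ∀ s : ℝ, (s, p) ∈ O := fun s => by
    refine ⟨⟨?_, ?_⟩, ?_⟩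
    · rw [mem_preimage, hpS]
      exact ⟨hpρ, h0ρ⟩
    · simpa [hτp] using hρ
    · change F (μ (s, p)) ∈ V₁
      rw [hpS, hF0 p hpρ]
      exact hpV₁
  have hkerG : ∀ q ∈ O, q.1 ∈ Ioo (0 : ℝ) 1 → fderiv ℝ G q (1, 0) ∈ formKernel (α (G q)) := by
    rintro ⟨s, x⟩ hq hs
    have h1 := (hFd (δ x) hq.1.1.1 (τ x) hq.1.2 s ⟨hs.1.le, hs.2.le⟩).hasDerivAt
      (Icc_mem_nhds hs.1 hs.2)
    have h2 : HasFDerivAt G (fderiv ℝ G (s, x)) (s, x) :=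
      ((hG.contDiffAt (hO.mem_nhds hq)).differentiableAt (by simp)).hasFDerivAt
    have h3 := h2.comp_hasDerivAt s ((hasDerivAt_id s).prodMk (hasDerivAt_const s x))
    have h4 : fderiv ℝ G (s, x) (1, 0) = K (G (s, x)) (τ x) := h3.unique h1
    rw [h4, (hV₁ _ hq.2).1]
    exact hker _ (hGV hq) _
  obtain ⟨A, w, -, hwo, hA, hpw, hAw⟩ := generalized_tube_lemma (isCompact_Icc (a := (0 : ℝ))
    (b := 1)) (isCompact_singleton (x := p)) hO (by rintro ⟨s, x⟩ ⟨-, rfl⟩; exact hpO s)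
  have hpw : p ∈ w := hpw rfl
  have hwO : ∀ x ∈ w, ∀ s ∈ Icc (0 : ℝ) 1, (s, x) ∈ O := fun x hx s hs => hAw ⟨hA hs, hx⟩
  have h1I : (1 : ℝ) ∈ Icc (0 : ℝ) 1 := by simp
  have h0I : (0 : ℝ) ∈ Icc (0 : ℝ) 1 := by simp
  have hslice : ∀ s : ℝ, ∀ x, HasFDerivAt (fun x : E => (s, x)) (ContinuousLinearMap.inr ℝ ℝ E) x :=
    fun s x => hasFDerivAt_prodMk_right s x
  let H : E → E := fun x => G (1, x)
  have hH : ContDiffOn ℝ ∞ H w := hG.comp (contDiff_const.prodMk contDiff_id).contDiffOn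
    fun x hx => hwO x hx 1 h1I
  have hHd : ∀ x ∈ w, ∀ v, fderiv ℝ H x v = fderiv ℝ G (1, x) (0, v) := fun x hx v => by
    have h2 : HasFDerivAt G (fderiv ℝ G (1, x)) (1, x) :=
      ((hG.contDiffAt (hO.mem_nhds (hwO x hx 1 h1I))).differentiableAt (by simp)).hasFDerivAt
    have := (h2.comp x (hslice 1 x)).fderiv
    rw [show H = G ∘ fun x => (1, x) from rfl, this]
    rfl
  have hG0 : ∀ x ∈ w, G (0, x) = δ x := fun x hx => by
    have hq := hwO x hx 0 h0I
    change F (δ x, (0 : ℝ) • τ x) = δ x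
    rw [zero_smul]
    exact hF0 _ hq.1.1.1
  have hG0d : ∀ x ∈ w, ∀ v, fderiv ℝ G (0, x) (0, v) = v - κ p v := fun x hx v => by
    have h2 : HasFDerivAt G (fderiv ℝ G (0, x)) (0, x) :=
      ((hG.contDiffAt (hO.mem_nhds (hwO x hx 0 h0I))).differentiableAt (by simp)).hasFDerivAt
    have h3 : HasFDerivAt (G ∘ fun x => (0, x)) (1 - κ p) x :=
      (hδ' x).congr_of_eventuallyEq ((hwo.eventually_mem hx).mono fun y hy => hG0 y hy)
    exact congrArg (fun A : E →L[ℝ] E => A v) ((h2.comp x (hslice 0 x)).unique h3)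
  have hHp : H p = p := by
    change F (μ (1, p)) = p
    rw [hpS, hF0 p hpρ]
  -- The derivative of `H` at `p` is the identity.
  have hHid : HasFDerivAt H ((ContinuousLinearEquiv.refl ℝ E : E ≃L[ℝ] E) : E →L[ℝ] E) p := by
    have hFp : HasFDerivAt F (fderiv ℝ F (p, 0)) (p, 0) :=
      ((hF.contDiffAt (hS.mem_nhds ⟨hpρ, h0ρ⟩)).differentiableAt (by simp)).hasFDerivAt
    have hinl : ∀ a, fderiv ℝ F (p, 0) (a, 0) = a := fun a => by
      have h3 : HasFDerivAt (F ∘ fun y : E => (y, (0 : E))) (ContinuousLinearMap.id ℝ E) p :=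
        (hasFDerivAt_id p).congr_of_eventuallyEq
          ((Metric.isOpen_ball.eventually_mem hpρ).mono fun y hy => hF0 y hy)
      exact congrArg (fun A : E →L[ℝ] E => A a)
        ((hFp.comp p (hasFDerivAt_prodMk_left p (0 : E))).unique h3)
    -- This is the flow equation at `s = 0`, where only a one-sided derivative is available.
    -- Linearity then extends it to all `t`.
    have hinr' : ∀ t ∈ Metric.ball (0 : E) ρ, fderiv ℝ F (p, 0) (0, t) = κ p t := fun t ht => by
      have h3 := hFd p hpρ t ht 0 h0I
      rw [zero_smul, hF0 p hpρ, hKp] at h3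
      have h4 : HasDerivAt (fun s : ℝ => (p, s • t)) ((0 : E), (1 : ℝ) • t) 0 :=
        (hasDerivAt_const 0 p).prodMk ((hasDerivAt_id (0 : ℝ)).smul_const t)
      have hFp' : HasFDerivAt F (fderiv ℝ F (p, 0)) ((fun s : ℝ => (p, s • t)) 0) := by
        simpa using hFp
      have h5 := (hFp'.comp_hasDerivAt 0 h4).hasDerivWithinAt (s := Icc 0 1)
      rw [one_smul] at h5
      exact (uniqueDiffOn_Icc one_pos 0 h0I).eq_deriv _ h5 h3
    have hinr : ∀ t, fderiv ℝ F (p, 0) (0, t) = κ p t := fun t => by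
      obtain ⟨c, hc, hct⟩ : ∃ c : ℝ, c ≠ 0 ∧ c • t ∈ Metric.ball (0 : E) ρ := by
        have hcont : ContinuousAt (fun c : ℝ => c • t) 0 := by fun_prop
        have h6 := hcont.eventually_mem (s := Metric.ball (0 : E) ρ)
          (by simpa using Metric.ball_mem_nhds (0 : E) hρ)
        obtain ⟨c, hc1, hc2⟩ := ((h6.filter_mono nhdsWithin_le_nhds).and
          (eventually_mem_nhdsWithin (a := (0 : ℝ)) (s := {0}ᶜ))).exists
        exact ⟨c, hc2, hc1⟩
      have h7 := hinr' _ hct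
      rw [map_smul, show ((0 : E), c • t) = c • ((0 : E), t) by simp, map_smul] at h7
      exact smul_right_injective E hc h7
    have hμp : HasFDerivAt (fun x => (δ x, τ x)) ((1 - κ p).prod (κ p)) p := (hδ' p).prodMk (hτ' p)
    have hFp' : HasFDerivAt F (fderiv ℝ F (p, 0)) ((fun x => (δ x, τ x)) p) := by
      simp only [hδp, hτp]
      exact hFp
    have hHF : H = F ∘ fun x => (δ x, τ x) := funext fun x => by
      change F (δ x, (1 : ℝ) • τ x) = _
      rw [one_smul]
      rfl
    rw [hHF]
    refine (hFp'.comp p hμp).congr_fderiv ?_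
    ext1 v
    change fderiv ℝ F (p, 0) (v - κ p v, κ p v) = v
    rw [show (v - κ p v, κ p v) = (v - κ p v, (0 : E)) + ((0 : E), κ p v) by simp, map_add,
      hinl, hinr, hκκ]
    abel
  obtain ⟨e, hpe, hew, heH, hesymm⟩ := exists_smooth_openPartialHomeomorph hwo hH hpw hHid
  have heval : ∀ x, e x = H x := fun x => congrFun heH x
  have hpt : p ∈ e.target := by
    have := e.map_source hpe
    rwa [heval, hHp] at this
  have hsymmp : e.symm p = p := by
    have := e.left_inv hpe
    rwa [heval, hHp] at this
  refine ⟨fun z => δ (e.symm z), e.target, e.open_target, hpt, fun z hz => ?_,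
    hδ.comp_contDiffOn hesymm, (by change δ (e.symm p) = p; rw [hsymmp, hδp]), fun z hz => ?_⟩
  · have hx := hew (e.map_target hz)
    rw [← e.right_inv hz, heval]
    exact hGV (hwO _ hx 1 h1I)
  · set x := e.symm z with hxdef
    have hx : x ∈ w := hew (e.map_target hz)
    have hHx : H x = z := by rw [← heval, e.right_inv hz]
    refine ⟨?_, ?_, ?_⟩
    · change δ x ∈ V
      rw [← hG0 x hx]
      exact hGV (hwO _ hx 0 h0I)
    · change κ p (x - κ p (x - p) - p) = 0
      rw [sub_right_comm, map_sub, hκκ, sub_self]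
    · have hsd : HasFDerivAt e.symm (fderiv ℝ e.symm z) z :=
        ((hesymm.contDiffAt (e.open_target.mem_nhds hz)).differentiableAt (by simp)).hasFDerivAt
      have hfd : fderiv ℝ (fun z => δ (e.symm z)) z = (1 - κ p) ∘L fderiv ℝ e.symm z :=
        ((hδ' (e.symm z)).comp z hsd).fderiv
      have hHx' : HasFDerivAt H (fderiv ℝ H x) x :=
        ((hH.contDiffAt (hwo.mem_nhds hx)).differentiableAt (by simp)).hasFDerivAt
      have hinv : ∀ v, fderiv ℝ H x (fderiv ℝ e.symm z v) = v := fun v => by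
        have h8 : HasFDerivAt (H ∘ e.symm) (ContinuousLinearMap.id ℝ E) z :=
          (hasFDerivAt_id z).congr_of_eventuallyEq
            ((e.open_target.eventually_mem hz).mono fun y hy => by
              rw [Function.comp_apply, ← heval, e.right_inv hy]; rfl)
        exact congrArg (fun A : E →L[ℝ] E => A v) ((hHx'.comp z hsd).unique h8)
      ext v
      have key := pullback_eq_of_homotopy hV hα hdα hO hG hGV hkerG (hwO x hx)
        fun i => fderiv ℝ e.symm z (v i)
      simp only [← hHd x hx, hinv, hG0d x hx, hG0 x hx] at key
      rw [show G (1, x) = z from hHx] at key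
      rw [hfd]
      exact key

end Slice
end ProductForms
end

noncomputable section
open scoped ContDiff Topology
open Filter Set

namespace ProductForms

/-! ### Forms of top degree on the range of a projection -/

section TopForms

variable {E : Type*} [NormedAddCommGroup E] [NormedSpace ℝ E] {m : ℕ}

/-- Both forms come from the `m`-dimensional range of `P`, where the alternating `m`-forms are
multiples of one determinant. -/
theorem apply_mul_apply_of_comp_eq {P : E →L[ℝ] E}
    (hrank : Module.finrank ℝ (LinearMap.range (P : E →ₗ[ℝ] E)) = m) (hm : 0 < m)
    {η ζ : E [⋀^Fin m]→L[ℝ] ℝ} (hη : η.compContinuousLinearMap P = η)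
    (hζ : ζ.compContinuousLinearMap P = ζ) (v w : Fin m → E) : η v * ζ w = η w * ζ v := by
  have : FiniteDimensional ℝ (LinearMap.range (P : E →ₗ[ℝ] E)) :=
    FiniteDimensional.of_finrank_pos (by omega)
  let e := Module.finBasisOfFinrankEq ℝ _ hrank
  have key : ∀ {θ : E [⋀^Fin m]→L[ℝ] ℝ}, θ.compContinuousLinearMap P = θ → ∀ u : Fin m → E,
      θ u = θ (fun i => e i) * e.det fun i => (P : E →ₗ[ℝ] E).rangeRestrict (u i) := by
    intro θ hθ u
    have h := (θ.toAlternatingMap.compLinearMap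
      (LinearMap.range (P : E →ₗ[ℝ] E)).subtype).eq_smul_basis_det e
    have h2 := congrArg
      (fun A : (LinearMap.range (P : E →ₗ[ℝ] E)) [⋀^Fin m]→ₗ[ℝ] ℝ =>
        A fun i => (P : E →ₗ[ℝ] E).rangeRestrict (u i)) h
    conv_lhs => rw [← hθ]
    exact h2
  rw [key hη v, key hη w, key hζ v, key hζ w]
  ring

/-- Outside slot `i₀` the added multiples of `b i₀` repeat an argument and contribute nothing. -/
theorem apply_add_smul_slot (γ : E [⋀^Fin m]→L[ℝ] ℝ) (b : Fin m → E) (i₀ : Fin m)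
    (c : Fin m → ℝ) : γ (fun i => b i + c i • b i₀) = (1 + c i₀) * γ b := by
  classical
  have key : ∀ s : Finset (Fin m), i₀ ∉ s →
      γ (fun i => if i ∈ s then b i + c i • b i₀ else b i) = γ b := by
    intro s
    induction s using Finset.induction_on with
    | empty => simp
    | insert j s hj ih =>
      intro hs
      rw [Finset.mem_insert, not_or] at hs
      set u : Fin m → E := fun i => if i ∈ s then b i + c i • b i₀ else b i with hu
      have h1 : (fun i => if i ∈ insert j s then b i + c i • b i₀ else b i) =
          Function.update u j (b j + c j • b i₀) := by
        funext i
        by_cases hi : i = j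
        · subst hi; simp
        · simp [hu, hi]
      have h2 : Function.update u j (b j) = u := by
        conv_rhs => rw [← Function.update_eq_self j u]
        simp [hu, hj]
      have h3 : γ (Function.update u j (b i₀)) = 0 := by
        refine γ.map_eq_zero_of_eq _ (i := j) (j := i₀) ?_ (Ne.symm hs.1)
        rw [Function.update_self, Function.update_of_ne hs.1]
        simp [hu, hs.2]
      rw [h1, γ.map_update_add, γ.map_update_smul, h2, h3, smul_zero, add_zero]
      exact ih hs.2
  have h := key (Finset.univ.erase i₀) (by simp)
  set u : Fin m → E := fun i => if i ∈ Finset.univ.erase i₀ then b i + c i • b i₀ else b i with hu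
  have h1 : (fun i => b i + c i • b i₀) = Function.update u i₀ ((1 + c i₀) • b i₀) := by
    funext i
    by_cases hi : i = i₀
    · subst hi; simp [add_smul]
    · simp [hu, hi]
  have h2 : Function.update u i₀ (b i₀) = u := by
    conv_rhs => rw [← Function.update_eq_self i₀ u]
    simp [hu]
  rw [h1, γ.map_update_smul, h2, h, smul_eq_mul]

end TopForms

/-! ### Straightening a closed form of rank equal to its degree -/

section Darboux

variable {E : Type} [NormedAddCommGroup E] [NormedSpace ℝ E] [FiniteDimensional ℝ E] {m : ℕ}

/-- With `ℓ e = 1`, integrate `g` along the direction `e` from the hyperplane `ℓ = 0` to `y`.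
Rescaling the integral to the unit interval reduces its smoothness to `contDiff_postcomp`, which
needs `E` and `ℝ` in the same universe. -/
theorem exists_contDiff_fderiv_apply_eq {g : E → ℝ} (hg : ContDiff ℝ ∞ g) {e : E} (he : e ≠ 0) :
    ∃ h : E → ℝ, ContDiff ℝ ∞ h ∧ ∀ y, fderiv ℝ h y e = g y := by
  obtain ⟨ℓ, hℓ⟩ := SeparatingDual.exists_eq_one (R := ℝ) he
  let c : E →ₗ[ℝ] C(unitInterval, E) :=
    { toFun := fun v => ⟨fun t => v + ((t : ℝ) - 1) • ℓ v • e, by fun_prop⟩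
      map_add' := fun v w => by
        ext t
        simp only [map_add, add_smul, smul_add, ContinuousMap.coe_mk, ContinuousMap.add_apply]
        abel
      map_smul' := fun a v => by
        ext t
        simp only [map_smul, smul_add, ContinuousMap.coe_mk, ContinuousMap.smul_apply,
          RingHom.id_apply, smul_assoc]
        rw [smul_comm ((t : ℝ) - 1) a] }
  let gc : C(E, ℝ) := ⟨g, hg.continuous⟩
  let h : E → ℝ := fun y =>
    ℓ y * primitiveCLM ℝ (postcomp unitInterval gc (c.toContinuousLinearMap y)) 1
  have hh : ContDiff ℝ ∞ h := ℓ.contDiff.mul ((ContinuousMap.evalCLM ℝ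
    (1 : unitInterval)).contDiff.comp ((primitiveCLM ℝ).contDiff.comp
      ((contDiff_postcomp (f := gc) hg).comp c.toContinuousLinearMap.contDiff)))
  have hval : ∀ y, h y = ∫ u in (0 : ℝ)..ℓ y, g (y + (u - ℓ y) • e) := fun y => by
    have hs := intervalIntegral.smul_integral_comp_mul_right (a := 0) (b := 1)
      (fun u => g (y + (u - ℓ y) • e)) (ℓ y)
    rw [zero_mul, one_mul] at hs
    rw [← hs, smul_eq_mul]
    change ℓ y * primitiveCLM ℝ (postcomp unitInterval gc (c.toContinuousLinearMap y)) 1 = _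
    rw [primitiveCLM_apply]
    congr 1
    refine intervalIntegral.integral_congr fun r hr => ?_
    have hr' : r ∈ Icc (0 : ℝ) 1 := by simpa [uIcc_of_le] using hr
    rw [IccExtend_of_mem _ _ hr']
    change g (y + (r - 1) • ℓ y • e) = g (y + (r * ℓ y - ℓ y) • e)
    rw [smul_smul, sub_mul, one_mul]
  refine ⟨h, hh, fun y => ?_⟩
  have h1 : HasDerivAt (fun s : ℝ => h (y + s • e)) (fderiv ℝ h y e) 0 := by
    have h2 : HasDerivAt (fun s : ℝ => y + s • e) e 0 := by
      simpa using ((hasDerivAt_id (0 : ℝ)).smul_const e).const_add y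
    have h3 : HasFDerivAt h (fderiv ℝ h y) (y + (0 : ℝ) • e) := by
      simpa using (hh.differentiable (by simp) y).hasFDerivAt
    exact h3.comp_hasDerivAt 0 h2
  have h4 : (fun s : ℝ => h (y + s • e)) = fun s => ∫ u in (0 : ℝ)..(ℓ y + s),
      g (y + (u - ℓ y) • e) := funext fun s => by
    rw [hval, map_add, map_smul, hℓ, smul_eq_mul, mul_one]
    refine intervalIntegral.integral_congr fun u _ => ?_
    rw [add_assoc, ← add_smul]
    congr 3
    ring
  have hcont : Continuous fun u => g (y + (u - ℓ y) • e) := by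
    have := hg.continuous
    fun_prop
  have h5 : HasDerivAt (fun s : ℝ => ∫ u in (0 : ℝ)..(ℓ y + s), g (y + (u - ℓ y) • e))
      (g (y + (ℓ y + 0 - ℓ y) • e)) 0 :=
    HasDerivAt.comp_const_add (ℓ y) 0 (hcont.integral_hasStrictDerivAt 0 (ℓ y + 0)).hasDerivAt
  rw [← h4] at h5
  simpa using h1.unique h5

/-- On the range of `P` it is enough to match one nonzero value. The map `y ↦ y + h y • b i₀`
multiplies `α p b` by one plus the derivative of `h` along `b i₀`, so `h` is chosen to make that
derivative `α y b / α p b - 1`. -/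
theorem exists_contDiff_straighten (hm : 0 < m) {V : Set E} (hV : IsOpen V)
    {α : E → E [⋀^Fin m]→L[ℝ] ℝ} (hα : ContDiffOn ℝ ∞ α V) {p : E} (hp : p ∈ V) {P : E →L[ℝ] E}
    (hPP : P * P = P) (hrank : Module.finrank ℝ (LinearMap.range (P : E →ₗ[ℝ] E)) = m)
    (hαP : (α p).compContinuousLinearMap P = α p) (hα0 : α p ≠ 0) :
    ∃ Θ : E → E, ContDiff ℝ ∞ Θ ∧ ∀ᶠ y in 𝓝 p, ∀ v : Fin m → E,
      α y (fun i => P (v i)) = α p fun i => fderiv ℝ Θ y (P (v i)) := by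
  have hP : ∀ x, P (P x) = P x := fun x => congrArg (fun A : E →L[ℝ] E => A x) hPP
  obtain ⟨b₀, hb₀⟩ : ∃ b, α p b ≠ 0 := by
    by_contra! h
    exact hα0 (ContinuousAlternatingMap.ext h)
  let b : Fin m → E := fun i => P (b₀ i)
  have hb : α p b ≠ 0 := by
    rw [← hαP] at hb₀
    exact hb₀
  have hPb : ∀ i, P (b i) = b i := fun i => hP _
  let i₀ : Fin m := ⟨0, hm⟩
  have he : b i₀ ≠ 0 := fun h => hb ((α p).map_coord_zero i₀ h)
  obtain ⟨g, hg, hgα⟩ := exists_contDiff_eventuallyEq hV (f := fun y => α y b / α p b - 1)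
    (fun y hy => (((contDiffAt_form_apply_const (hα.contDiffAt (hV.mem_nhds hy)) b).div_const
      _).sub contDiffAt_const).contDiffWithinAt) hp
  obtain ⟨h, hh, hhg⟩ := exists_contDiff_fderiv_apply_eq hg he
  refine ⟨fun y => y + h y • b i₀, contDiff_id.add (hh.smul contDiff_const), ?_⟩
  filter_upwards [hgα] with y hy v
  have hd : fderiv ℝ (fun y => y + h y • b i₀) y =
      ContinuousLinearMap.id ℝ E + (fderiv ℝ h y).smulRight (b i₀) :=
    ((hasFDerivAt_id y).add
      ((hh.differentiable (by simp) y).hasFDerivAt.smul_const (b i₀))).fderiv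
  set D := fderiv ℝ (fun y => y + h y • b i₀) y
  have hinv : ∀ η : E [⋀^Fin m]→L[ℝ] ℝ, (η.compContinuousLinearMap P).compContinuousLinearMap P =
      η.compContinuousLinearMap P := fun η => by
    ext u
    change η (fun i => P (P (u i))) = η fun i => P (u i)
    simp only [hP]
  have h1 := apply_mul_apply_of_comp_eq hrank hm (hinv (α y)) hαP v b
  have h2 := apply_mul_apply_of_comp_eq hrank hm
    (hinv ((α p).compContinuousLinearMap D)) hαP v b
  have h3 : (α y).compContinuousLinearMap P b =
      ((α p).compContinuousLinearMap D).compContinuousLinearMap P b := by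
    change α y (fun i => P (b i)) = α p fun i => D (P (b i))
    simp only [hPb, hd]
    have h4 := apply_add_smul_slot (α p) b i₀ fun i => fderiv ℝ h y (b i)
    change α y b = α p fun i => b i + fderiv ℝ h y (b i) • b i₀
    rw [h4, hhg, hy]
    field_simp
    ring
  rw [h3, ← h2] at h1
  exact mul_right_cancel₀ hb h1

/-- A closed form that locally comes from a smooth family of projections of rank equal to its
degree is locally the pullback of a constant form. -/
theorem exists_darboux (hm : 0 < m) {V : Set E} (hV : IsOpen V)
    {α : E → E [⋀^Fin m]→L[ℝ] ℝ} (hα : ContDiffOn ℝ ∞ α V) (hdα : IsClosedForm V α)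
    {P : E → E →L[ℝ] E} (hP : ContDiffOn ℝ ∞ P V)
    (hαP : ∀ x ∈ V, (α x).compContinuousLinearMap (P x) = α x) {p : E} (hp : p ∈ V)
    (hPP : ∀ x ∈ V, P x * P x = P x)
    (hrank : Module.finrank ℝ (LinearMap.range (P p : E →ₗ[ℝ] E)) = m) (hα0 : α p ≠ 0) :
    ∃ f : E → E, ∃ W : Set E, IsOpen W ∧ p ∈ W ∧ W ⊆ V ∧ ContDiffOn ℝ ∞ f W ∧
      ∀ x ∈ W, α x = (α p).compContinuousLinearMap (fderiv ℝ f x) := by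
  classical
  have hker : ∀ x ∈ V, ∀ t, (1 - P x) t ∈ formKernel (α x) := by
    intro x hx t w i
    rw [← hαP x hx]
    refine (α x).map_coord_zero i ?_
    change P x (Function.update w i ((1 - P x) t) i) = 0
    rw [Function.update_self]
    have := congrArg (fun A : E →L[ℝ] E => A t) (hPP x hx)
    change P x (P x t) = P x t at this
    change P x (t - P x t) = 0
    rw [map_sub, this, sub_self]
  obtain ⟨f, W, hW, hpW, hWV, hf, hfp, hfW⟩ := exists_pullback_from_slice hV hα hdα
    (κ := fun x => 1 - P x) (contDiffOn_const.sub hP) hker hp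
    (by rw [mul_sub, sub_mul, sub_mul, hPP p hp]; simp)
  obtain ⟨Θ, hΘ, hΘα⟩ := exists_contDiff_straighten hm hV hα hp (hPP p hp) hrank (hαP p hp) hα0
  have hfc : Tendsto f (𝓝 p) (𝓝 p) := by
    have := (hf.continuousOn.continuousAt (hW.mem_nhds hpW)).tendsto
    rwa [hfp] at this
  obtain ⟨W', hW', hW'o, hpW'⟩ := eventually_nhds_iff.1 ((hfc.eventually hΘα).and
    (hW.eventually_mem hpW))
  refine ⟨fun x => Θ (f x), W', hW'o, hpW', fun x hx => hWV (hW' x hx).2,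
    hΘ.comp_contDiffOn (hf.mono fun x hx => (hW' x hx).2), fun x hx => ?_⟩
  have hxW := (hW' x hx).2
  have hfd : HasFDerivAt f (fderiv ℝ f x) x :=
    ((hf.contDiffAt (hW.mem_nhds hxW)).differentiableAt (by simp)).hasFDerivAt
  have hd : fderiv ℝ (fun x => Θ (f x)) x = fderiv ℝ Θ (f x) ∘L fderiv ℝ f x :=
    ((hΘ.differentiable (by simp) (f x)).hasFDerivAt.comp x hfd).fderiv
  -- `f` takes values in the slice `p + range (P p)`, so its derivative takes values in the range,
  -- where `Θ` straightens the form.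
  have hPf : ∀ v, P p (fderiv ℝ f x v) = fderiv ℝ f x v := fun v => by
    have h1 : HasFDerivAt (fun y => (1 - P p) (f y - p)) ((1 - P p) ∘L fderiv ℝ f x) x :=
      (1 - P p).hasFDerivAt.comp x (hfd.sub_const p)
    have h2 : HasFDerivAt (fun y => (1 - P p) (f y - p)) (0 : E →L[ℝ] E) x :=
      (hasFDerivAt_const (0 : E) x).congr_of_eventuallyEq
        ((hW.eventually_mem hxW).mono fun y hy => (hfW y hy).2.1)
    have h3 := congrArg (fun A : E →L[ℝ] E => A v) (h1.unique h2)
    exact (sub_eq_zero.1 h3).symm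
  ext v
  rw [(hfW x hxW).2.2, hd]
  have := (hW' x hx).1 fun i => fderiv ℝ f x (v i)
  simp only [hPf] at this
  exact this

end Darboux
end ProductForms
end

noncomputable section
open scoped ContDiff Topology
open Filter Set

namespace ProductForms

/-! ### Flatness makes the pieces closed -/

section Flatness

variable {E : Type*} [NormedAddCommGroup E] [NormedSpace ℝ E] {m k : ℕ}

theorem formRank_comp_equiv (γ : E [⋀^Fin m]→L[ℝ] ℝ) (L : E ≃L[ℝ] E) :
    formRank (γ.compContinuousLinearMap (L : E →L[ℝ] E)) = formRank γ := by
  classical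
  refine (Submodule.Quotient.equiv _ _ L.toLinearEquiv ?_).finrank_eq
  ext v
  rw [Submodule.mem_map_equiv, mem_formKernel, mem_formKernel]
  have h : ∀ (w : Fin m → E) (i : Fin m),
      γ.compContinuousLinearMap (L : E →L[ℝ] E) (Function.update w i (L.symm v)) =
        γ (Function.update (L ∘ w) i v) := fun w i => by
    change γ (L ∘ Function.update w i (L.symm v)) = _
    rw [Function.comp_update, L.apply_symm_apply]
  constructor
  · intro hv w i
    have := hv (L.symm ∘ w) i
    change γ.compContinuousLinearMap (L : E →L[ℝ] E)
      (Function.update (L.symm ∘ w) i (L.symm v)) = 0 at this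
    rw [h] at this
    simpa [← Function.comp_assoc] using this
  · intro hv w i
    exact (h w i).trans (hv _ i)

theorem formRank_zero : formRank (0 : E [⋀^Fin m]→L[ℝ] ℝ) = 0 := by
  have : formKernel (0 : E [⋀^Fin m]→L[ℝ] ℝ) = ⊤ :=
    eq_top_iff.2 fun v _ w i => rfl
  rw [formRank, this]
  exact Module.finrank_zero_of_subsingleton

variable {V : Set E} {Ω : E → E [⋀^Fin m]→L[ℝ] ℝ} {α : Fin k → E → E [⋀^Fin m]→L[ℝ] ℝ}

theorem IsRankDecomposition.arePieces (h : IsRankDecomposition V Ω α) {x : E} (hx : x ∈ V) :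
    ArePieces (Ω x) fun i => α i x :=
  ⟨fun i => h.rank_eq i x hx, h.sum_eq x hx⟩

variable [FiniteDimensional ℝ E]

theorem exists_equiv_of_injective {A : E →L[ℝ] E} (hA : ∀ v, A v = 0 → v = 0) :
    ∃ L : E ≃L[ℝ] E, (L : E →L[ℝ] E) = A := by
  have hinj : Function.Injective (A : E →ₗ[ℝ] E) := (injective_iff_map_eq_zero _).2 hA
  exact ⟨(LinearEquiv.ofInjectiveEndo (A : E →ₗ[ℝ] E) hinj).toContinuousLinearEquiv, by ext; rfl⟩

theorem exists_equiv_eq_fderiv {φ : OpenPartialHomeomorph E E}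
    (hφ : ContDiffOn ℝ ∞ φ φ.source) (hφ' : ContDiffOn ℝ ∞ φ.symm φ.target) {x : E}
    (hx : x ∈ φ.source) : ∃ L : E ≃L[ℝ] E, (L : E →L[ℝ] E) = fderiv ℝ φ x := by
  have h1 : HasFDerivAt φ (fderiv ℝ φ x) x :=
    ((hφ.contDiffAt (φ.open_source.mem_nhds hx)).differentiableAt (by simp)).hasFDerivAt
  have h2 : HasFDerivAt φ.symm (fderiv ℝ φ.symm (φ x)) (φ x) :=
    ((hφ'.contDiffAt (φ.open_target.mem_nhds (φ.map_source hx))).differentiableAt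
      (by simp)).hasFDerivAt
  have h3 : HasFDerivAt (φ.symm ∘ φ) (ContinuousLinearMap.id ℝ E) x :=
    (hasFDerivAt_id x).congr_of_eventuallyEq
      ((φ.open_source.eventually_mem hx).mono fun y hy => φ.left_inv hy)
  have h4 := (h2.comp x h1).unique h3
  refine exists_equiv_of_injective fun v hv => ?_
  have h5 := congrArg (fun A : E →L[ℝ] E => A v) h4
  change fderiv ℝ φ.symm (φ x) (fderiv ℝ φ x v) = v at h5
  rw [← h5, hv, map_zero]

/-- Pulling the constant forms `α i p` back by the flat chart gives another decomposition near `p`,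
with closed pieces. Near `p` the given pieces are a fixed reordering of these. -/
theorem IsRankDecomposition.extDeriv_eq_zero (h : IsRankDecomposition V Ω α) (hm : 0 < m)
    (hE : Module.finrank ℝ E = k * m) (hV : IsOpen V)
    (hsplit : ∀ x ∈ V, ∃ P : Fin k → E →L[ℝ] E, IsSplitting (Ω x) P) {U : Set E} {p : E}
    (hp : p ∈ V) (hflat : IsFlatNear U Ω p) (i : Fin k) : extDeriv (α i) p = 0 := by
  obtain ⟨φ, hpφ, -, -, hφ, hφ', hφΩ⟩ := hflat
  have hS : IsOpen (φ.source ∩ V) := φ.open_source.inter hV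
  have hφx : ∀ x ∈ φ.source, ContDiffAt ℝ ∞ φ x := fun x hx =>
    hφ.contDiffAt (φ.open_source.mem_nhds hx)
  let β : Fin k → E → E [⋀^Fin m]→L[ℝ] ℝ :=
    fun i x => (α i p).compContinuousLinearMap (fderiv ℝ φ x)
  have hβ : ∀ i, ContinuousOn (β i) (φ.source ∩ V) := fun i x hx =>
    (contDiffAt_form_comp (n := ∞) contDiffAt_const
      ((hφx x hx.1).fderiv_right (by simp))).continuousAt.continuousWithinAt
  have hβp : ∀ x ∈ φ.source ∩ V, ArePieces (Ω x) fun i => β i x := by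
    intro x hx
    obtain ⟨L, hL⟩ := exists_equiv_eq_fderiv hφ hφ' hx.1
    refine ⟨fun i => ?_, ?_⟩
    · change formRank ((α i p).compContinuousLinearMap (fderiv ℝ φ x)) = m
      rw [← hL, formRank_comp_equiv]
      exact h.rank_eq i p hp
    · rw [← hφΩ x hx.1, h.sum_eq p hp]
      ext v
      simp [β]
  obtain ⟨σ, hσ⟩ := eventually_eq_perm hm hE hS (fun x hx => hsplit x hx.2) hβ
    (fun i => (h.smooth i).continuousOn.mono inter_subset_right) hβp
    (fun x hx => h.arePieces hx.2) ⟨hpφ, hp⟩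
  rw [Filter.EventuallyEq.extDeriv_eq (hσ.mono fun x hx => hx i)]
  exact extDeriv_pullback_eq_zero (α := fun _ => α (σ i) p) isOpen_univ contDiffOn_const
    (fun x _ => by
      rw [extDeriv, fderiv_fun_const]
      exact map_zero (ContinuousAlternatingMap.alternatizeUncurryFinCLM ℝ E ℝ)) (hφx p hpφ) trivial

end Flatness

/-! ### Closed pieces give a flat chart -/

section ClosedPieces

variable {E : Type} [NormedAddCommGroup E] [NormedSpace ℝ E] [FiniteDimensional ℝ E] {m k : ℕ}
  {V : Set E} {Ω : E → E [⋀^Fin m]→L[ℝ] ℝ} {α : Fin k → E → E [⋀^Fin m]→L[ℝ] ℝ}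

theorem IsRankDecomposition.isFlatNear (h : IsRankDecomposition V Ω α) (hm : 0 < m)
    (hE : Module.finrank ℝ E = k * m) (hV : IsOpen V) (hΩ : ContDiffOn ℝ ∞ Ω V)
    (hsplit : ∀ x ∈ V, ∃ P : Fin k → E →L[ℝ] E, IsSplitting (Ω x) P)
    (hclosed : ∀ i, IsClosedForm V (α i)) {p : E} (hp : p ∈ V) : IsFlatNear V Ω p := by
  classical
  have := FiniteDimensional.complete ℝ E
  obtain ⟨P, W, hW, hpW, hWV, hP, hPW⟩ := exists_smooth_splitting hm hV hΩ hsplit hp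
  obtain ⟨σ, hσ⟩ := eventually_eq_perm hm hE hW (fun x hx => hsplit x (hWV hx))
    (fun i => (h.smooth i).continuousOn.mono hWV)
    (fun i x hx => (contDiffAt_form_comp (hΩ.contDiffAt (hV.mem_nhds (hWV hx)))
      ((hP i).contDiffAt (hW.mem_nhds hx))).continuousAt.continuousWithinAt)
    (fun x hx => h.arePieces (hWV hx)) (fun x hx => (hPW x hx).arePieces hm) hpW
  obtain ⟨W', hW', hW'o, hpW'⟩ := eventually_nhds_iff.1 (hσ.and (hW.eventually_mem hpW))
  have hW'V : W' ⊆ V := fun x hx => hWV (hW' x hx).2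
  have hPP : ∀ i, ∀ x ∈ W', P i x * P i x = P i x := fun i x hx => (hPW x (hW' x hx).2).mul_self i
  have hαP : ∀ i, ∀ x ∈ W', (α (σ i) x).compContinuousLinearMap (P i x) = α (σ i) x := by
    intro i x hx
    rw [← (hW' x hx).1 i]
    ext v
    change Ω x (fun j => P i x (P i x (v j))) = Ω x fun j => P i x (v j)
    have : ∀ w, P i x (P i x w) = P i x w := fun w =>
      congrArg (fun A : E →L[ℝ] E => A w) (hPP i x hx)
    simp only [this]
  have hsum : ∀ x ∈ W', Ω x = ∑ i, α (σ i) x := fun x hx => by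
    rw [h.sum_eq x (hW'V hx)]
    exact (Equiv.sum_comp σ fun i => α i x).symm
  choose f Wf hWf hpWf hWfV hf hfα using fun i => exists_darboux hm hW'o
    ((h.smooth (σ i)).mono hW'V) (fun x hx => hclosed (σ i) x (hW'V hx))
    ((hP i).mono fun x hx => (hW' x hx).2) (hαP i) hpW' (hPP i)
    ((hPW p hpW).rank_eq i) fun h0 => by
      have := h.rank_eq (σ i) p hp
      rw [h0, formRank_zero] at this
      omega
  obtain ⟨S, hS, hSo, hpS⟩ := eventually_nhds_iff.1 ((hW'o.eventually_mem hpW').and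
    (eventually_all.2 fun i => (hWf i).eventually_mem (hpWf i)))
  have hfS : ∀ i, ∀ x ∈ S, ContDiffAt ℝ ∞ (f i) x := fun i x hx =>
    (hf i).contDiffAt ((hWf i).mem_nhds ((hS x hx).2 i))
  -- The form `α (σ i) p` sees only the `P i p` component of a vector. Taking that component from `f
  -- i` makes `φ` pull back all the pieces at once.
  let φ : E → E := fun x => ∑ i, P i p (f i x - f i p)
  have hφ : ContDiffOn ℝ ∞ φ S := fun x hx => (ContDiffAt.sum fun i _ =>
    (P i p).contDiff.contDiffAt.comp x ((hfS i x hx).sub contDiffAt_const)).contDiffWithinAt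
  have hφ' : ∀ x ∈ S, HasFDerivAt φ (∑ i, P i p ∘L fderiv ℝ (f i) x) x := fun x hx =>
    HasFDerivAt.fun_sum fun i _ => (P i p).hasFDerivAt.comp x
      (((hfS i x hx).differentiableAt (by simp)).hasFDerivAt.sub_const _)
  have hproj : ∀ i, ∀ x ∈ S, ∀ v, P i p (fderiv ℝ φ x v) = P i p (fderiv ℝ (f i) x v) := by
    intro i x hx v
    rw [(hφ' x hx).fderiv, sum_apply, map_sum, Finset.sum_eq_single i]
    · exact congrArg (fun A : E →L[ℝ] E => A (fderiv ℝ (f i) x v)) ((hPW p hpW).mul_self i)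
    · intro j _ hj
      exact congrArg (fun A : E →L[ℝ] E => A (fderiv ℝ (f j) x v))
        ((hPW p hpW).mul_ne i j (Ne.symm hj))
    · simp
  have hpull : ∀ x ∈ S, (Ω p).compContinuousLinearMap (fderiv ℝ φ x) = Ω x := by
    intro x hx
    ext v
    rw [hsum x (hS x hx).1, hsum p hpW', ContinuousAlternatingMap.sum_apply]
    change (∑ i, α (σ i) p) (fun j => fderiv ℝ φ x (v j)) = _
    rw [ContinuousAlternatingMap.sum_apply]
    refine Finset.sum_congr rfl fun i _ => ?_
    rw [hfα i x ((hS x hx).2 i), ← hαP i p hpW']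
    change α (σ i) p (fun j => P i p (fderiv ℝ φ x (v j))) =
      α (σ i) p fun j => P i p (fderiv ℝ (f i) x (v j))
    simp only [hproj i x hx]
  -- A vector killed by the derivative of `φ` at `p` lies in the kernel of `Ω p`, which is zero; so
  -- `φ` is a local diffeomorphism.
  obtain ⟨L, hL⟩ := exists_equiv_of_injective (A := fderiv ℝ φ p) fun v hv => by
    have hmem : v ∈ formKernel (Ω p) := fun w i => by
      rw [← hpull p hpS]
      refine (Ω p).map_coord_zero i ?_
      change fderiv ℝ φ p (Function.update w i v i) = 0
      rw [Function.update_self, hv]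
    rwa [(hPW p hpW).ker_eq, Submodule.mem_bot] at hmem
  obtain ⟨e, hpe, heS, heφ, hesymm⟩ := exists_smooth_openPartialHomeomorph hSo hφ hpS
    (f' := L) (by rw [hL, (hφ' p hpS).fderiv]; exact hφ' p hpS)
  refine ⟨e, hpe, fun x hx => hW'V (hS x (heS hx)).1, ?_, ?_, hesymm, fun x hx => ?_⟩
  · rw [heφ]
    simp [φ]
  · rw [heφ]
    exact hφ.mono heS
  · rw [heφ]
    exact hpull x (heS hx)

end ClosedPieces
end ProductForms
end

theorem mainTheorem5 (k m : ℕ) (hk : 2 ≤ k) (hm : 2 < m)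
    (U : Set (ProductForms.Space k m)) (hU : IsOpen U)
    (ω : ProductForms.Space k m → ProductForms.Space k m [⋀^Fin m]→L[ℝ] ℝ)
    (hω : ProductForms.IsSmoothForm U ω) (hclosed : ProductForms.IsClosedForm U ω)
    (htype : ∀ x ∈ U, ProductForms.SameLinearType (ω x) (ProductForms.standardForm k m)) :
    -- existence, on every simply connected open part of `U`
    (∀ V ⊆ U, IsOpen V → IsSimplyConnected V →
      ∃ α : Fin k → ProductForms.Space k m → ProductForms.Space k m [⋀^Fin m]→L[ℝ] ℝ,
        ProductForms.IsRankDecomposition V ω α) ∧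
    -- uniqueness up to one permutation, on every connected open part of `U`
    (∀ V ⊆ U, IsOpen V → IsPreconnected V →
      ∀ α β : Fin k → ProductForms.Space k m → ProductForms.Space k m [⋀^Fin m]→L[ℝ] ℝ,
        ProductForms.IsRankDecomposition V ω α → ProductForms.IsRankDecomposition V ω β →
        ∃ σ : Equiv.Perm (Fin k), ∀ i, ∀ x ∈ V, β i x = α (σ i) x) ∧
    -- flatness, on every open part of `U` (in particular on `U`) with a decomposition
    (∀ V ⊆ U, IsOpen V →
      ∀ α : Fin k → ProductForms.Space k m → ProductForms.Space k m [⋀^Fin m]→L[ℝ] ℝ,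
        ProductForms.IsRankDecomposition V ω α →
        (ProductForms.IsFlat V ω ↔ ∀ i, ProductForms.IsClosedForm V (α i))) ∧
    -- flatness of `U`, also when there is no decomposition on all of `U`
    (ProductForms.IsFlat U ω ↔
      ∀ V ⊆ U, IsOpen V →
        ∀ α : Fin k → ProductForms.Space k m → ProductForms.Space k m [⋀^Fin m]→L[ℝ] ℝ,
          ProductForms.IsRankDecomposition V ω α →
          ∀ i, ProductForms.IsClosedForm V (α i)) := by
  have hm₀ : 0 < m := by omega
  have hE : Module.finrank ℝ (ProductForms.Space k m) = k * m := by simp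
  have hsplit : ∀ x ∈ U, ∃ P, ProductForms.IsSplitting (ω x) P := fun x hx =>
    (htype x hx).exists_isSplitting hm
  refine ⟨fun V hVU hV hV' => ?_, fun V hVU hV hV' α β hα hβ => ?_,
    fun V hVU hV α hα => ⟨fun hflat i x hx => ?_, fun hdα p hp => ?_⟩,
    fun hflat V hVU hV α hα i x hx => ?_, fun hdα p hp => ?_⟩
  · exact ProductForms.exists_rankDecomposition hm₀ hE hV hV' (hω.mono hVU)
      fun x hx => hsplit x (hVU hx)
  · exact ProductForms.exists_perm_of_isPreconnected hm₀ hE hV' (fun x hx => hsplit x (hVU hx))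
      (fun i => (hα.smooth i).continuousOn) (fun i => (hβ.smooth i).continuousOn)
      (fun x hx => hα.arePieces hx) fun x hx => hβ.arePieces hx
  · exact hα.extDeriv_eq_zero hm₀ hE hV (fun x hx => hsplit x (hVU hx)) hx (hflat x hx) i
  · exact hα.isFlatNear hm₀ hE hV (hω.mono hVU) (fun x hx => hsplit x (hVU hx)) hdα hp
  · exact hα.extDeriv_eq_zero hm₀ hE hV (fun x hx => hsplit x (hVU hx)) hx (hflat x (hVU hx)) i
  · obtain ⟨γ, W, hW, hpW, hWU, hγ, hγW⟩ :=
      ProductForms.exists_local_pieces hm₀ hU hω hsplit hp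
    have hdec : ProductForms.IsRankDecomposition W ω γ :=
      ⟨hγ, fun i x hx => (hγW x hx).1 i, fun x hx => (hγW x hx).2⟩
    obtain ⟨φ, h₁, h₂, h₃⟩ := hdec.isFlatNear hm₀ hE hW (hω.mono hWU)
      (fun x hx => hsplit x (hWU hx)) (hdα W hWU hW γ hdec) hpW
    exact ⟨φ, h₁, h₂.trans hWU, h₃⟩
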